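/- There is a deterministic algorithm (a program for a random access machine with logarithmic cost) which, given any finite simple undirected graph $G=(V,E)$ and any integer $k\ge 0$, outputs a set $\mathcal C$ of at most $k$ cliques of $G$ such that every edge of $G$ is contained in at least one clique of $\mathcal C$, if such a set exists, and outputs NO otherwise (the problem Edge Clique Cover). On every input it runs in time $1.4423^{dk}\,n^{O(1)}$, that is, in time at most $A\cdot 1.4423^{dk}\,(n+1)^{c}$ for constants $A,c$ that do not depend on the input. Here $n=|V|$, and $d$ is the degeneracy of $G$: the smallest $d\ge 0$ such that every nonempty subgraph of $G$ has a vertex with at most $d$ neighbours in that subgraph. In particular, Edge Clique Cover parameterized by $d$ and $k$ is fixed-parameter tractable. -/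

import Mathlib

namespace EdgeCliqueCover

/-! ### Graphs: degeneracy and edge clique covers -/

section Graphs

variable {V : Type*}

/-- The degeneracy of a finite graph: the smallest `d` such that every nonempty subgraph contains
a vertex that has at most `d` neighbours in the subgraph. -/
noncomputable def degeneracy (G : SimpleGraph V) : ℕ :=
  sInf {d : ℕ | ∀ H : G.Subgraph, H.verts.Nonempty →
    ∃ v ∈ H.verts, (H.neighborSet v).ncard ≤ d}

/-- `𝒞` is a set of cliques of `G` such that every edge of `G` is contained in a member of `𝒞`. -/
def IsEdgeCliqueCover (G : SimpleGraph V) (𝒞 : Finset (Finset V)) : Prop :=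
  (∀ C ∈ 𝒞, G.IsClique (C : Set V)) ∧
    ∀ u v : V, G.Adj u v → ∃ C ∈ 𝒞, u ∈ C ∧ v ∈ C

/-- `ans` is a correct answer to the instance `(G, k)` of Edge Clique Cover: an edge clique cover
with at most `k` cliques, or `none` (i.e. "NO") if there is no such cover. -/
def IsCorrectAnswer (G : SimpleGraph V) (k : ℕ) : Option (Finset (Finset V)) → Prop
  | some 𝒞 => IsEdgeCliqueCover G 𝒞 ∧ 𝒞.card ≤ k
  | none => ¬ ∃ 𝒞 : Finset (Finset V), IsEdgeCliqueCover G 𝒞 ∧ 𝒞.card ≤ k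

end Graphs

/-! ### Random access machines with logarithmic cost

A program is built from finitely many instructions by sequencing, conditionals and loops. It works
on registers and on random access memory banks (arrays), all holding natural numbers; the names of
the registers and of the banks are constants of the program, the addresses inside a bank are
computed. Every operation is charged the bit lengths of all the numbers (addresses included) that it
handles. -/

/-- The contents of the registers and of the memory banks. -/
structure State where
  reg : ℕ → ℕ
  mem : ℕ → ℕ → ℕ

/-- The arithmetic operations. -/
inductive Op
  | add | sub | mul | div | eq | lt

/-- The value of an operation (truncated subtraction, quotient rounded down, comparisons with value
`1` or `0`). -/
def Op.eval : Op → ℕ → ℕ → ℕ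
  | .add, x, y => x + y
  | .sub, x, y => x - y
  | .mul, x, y => x * y
  | .div, x, y => x / y
  | .eq, x, y => if x = y then 1 else 0
  | .lt, x, y => if x < y then 1 else 0

/-- Expressions: constants, registers, memory cells `mem b e` (the cell of bank `b` at the computed
address `e`), and operations. -/
inductive Expr
  | const (c : ℕ)
  | reg (i : ℕ)
  | mem (b : ℕ) (e : Expr)
  | op (o : Op) (e₁ e₂ : Expr)

/-- The value of an expression. -/
def Expr.eval (s : State) : Expr → ℕ
  | .const c => c
  | .reg i => s.reg i
  | .mem b e => s.mem b (e.eval s)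
  | .op o e₁ e₂ => o.eval (e₁.eval s) (e₂.eval s)

/-- The cost of handling the number `x`: its bit length plus one. -/
def len (x : ℕ) : ℕ := Nat.size x + 1

/-- The cost of evaluating an expression. -/
def Expr.cost (s : State) : Expr → ℕ
  | .const c => len c
  | .reg i => len (s.reg i)
  | .mem b e => e.cost s + len (e.eval s) + len (s.mem b (e.eval s))
  | .op _ e₁ e₂ => e₁.cost s + e₂.cost s + len (e₁.eval s) + len (e₂.eval s)

/-- Programs. -/
inductive Prog
  /-- do nothing -/
  | skip
  /-- register `i` receives the value of `e` -/
  | assign (i : ℕ) (e : Expr)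
  /-- the cell of bank `b` at address `a` receives the value of `e` -/
  | store (b : ℕ) (a e : Expr)
  | seq (p q : Prog)
  /-- `p` if the value of `e` is not `0`, otherwise `q` -/
  | cond (e : Expr) (p q : Prog)
  /-- repeat `p` as long as the value of `e` is not `0` -/
  | loop (e : Expr) (p : Prog)

/-- `Run p s s' t`: started in the state `s`, the program `p` halts in the state `s'`, and the time
that it takes is `t`. -/
inductive Run : Prog → State → State → ℕ → Prop
  | skip (s : State) : Run .skip s s 1
  | assign (i : ℕ) (e : Expr) (s : State) :
      Run (.assign i e) s ⟨Function.update s.reg i (e.eval s), s.mem⟩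
        (e.cost s + len (e.eval s))
  | store (b : ℕ) (a e : Expr) (s : State) :
      Run (.store b a e) s
        ⟨s.reg, Function.update s.mem b (Function.update (s.mem b) (a.eval s) (e.eval s))⟩
        (a.cost s + e.cost s + len (a.eval s) + len (e.eval s))
  | seq {p q : Prog} {s s₁ s₂ : State} {t₁ t₂ : ℕ} :
      Run p s s₁ t₁ → Run q s₁ s₂ t₂ → Run (.seq p q) s s₂ (t₁ + t₂)
  | cond_true {e : Expr} {p q : Prog} {s s₁ : State} {t : ℕ} :
      e.eval s ≠ 0 → Run p s s₁ t → Run (.cond e p q) s s₁ (e.cost s + len (e.eval s) + t)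
  | cond_false {e : Expr} {p q : Prog} {s s₁ : State} {t : ℕ} :
      e.eval s = 0 → Run q s s₁ t → Run (.cond e p q) s s₁ (e.cost s + len (e.eval s) + t)
  | loop_true {e : Expr} {p : Prog} {s s₁ s₂ : State} {t₁ t₂ : ℕ} :
      e.eval s ≠ 0 → Run p s s₁ t₁ → Run (.loop e p) s₁ s₂ t₂ →
        Run (.loop e p) s s₂ (e.cost s + len (e.eval s) + t₁ + t₂)
  | loop_false {e : Expr} {p : Prog} {s : State} :
      e.eval s = 0 → Run (.loop e p) s s (e.cost s + len (e.eval s))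

/-- Programs are deterministic: the final state and the time are determined by the start. -/
theorem Run.deterministic {p : Prog} {s s₁ s₂ : State} {t₁ t₂ : ℕ}
    (h₁ : Run p s s₁ t₁) (h₂ : Run p s s₂ t₂) : s₁ = s₂ ∧ t₁ = t₂ := by
  induction h₁ generalizing s₂ t₂ with
  | skip => cases h₂; exact ⟨rfl, rfl⟩
  | assign => cases h₂; exact ⟨rfl, rfl⟩
  | store => cases h₂; exact ⟨rfl, rfl⟩
  | seq _ _ ih ih' =>
    cases h₂ with
    | seq a b =>
      obtain ⟨rfl, rfl⟩ := ih a
      obtain ⟨rfl, rfl⟩ := ih' b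
      exact ⟨rfl, rfl⟩
  | cond_true h _ ih =>
    cases h₂ with
    | cond_true _ a => obtain ⟨rfl, rfl⟩ := ih a; exact ⟨rfl, rfl⟩
    | cond_false h' _ => exact absurd h' h
  | cond_false h _ ih =>
    cases h₂ with
    | cond_true h' _ => exact absurd h h'
    | cond_false _ a => obtain ⟨rfl, rfl⟩ := ih a; exact ⟨rfl, rfl⟩
  | loop_true h _ _ ih ih' =>
    cases h₂ with
    | loop_true _ a b =>
      obtain ⟨rfl, rfl⟩ := ih a
      obtain ⟨rfl, rfl⟩ := ih' b
      exact ⟨rfl, rfl⟩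
    | loop_false h' => exact absurd h' h
  | loop_false h =>
    cases h₂ with
    | loop_true h' _ _ => exact absurd h h'
    | loop_false _ => exact ⟨rfl, rfl⟩

/-! ### Input and output -/

open Classical in
/-- The input `(G, k)`, where `G` is a graph with vertices `0, …, n - 1`: register `0` holds `n`,
register `1` holds `k`, and bank `0` holds the adjacency matrix of `G`, its entry `(i, j)` at the
address `i * n + j`. All the other registers and cells hold `0`. -/
noncomputable def input {n : ℕ} (G : SimpleGraph (Fin n)) (k : ℕ) : State where
  reg i := if i = 0 then n else if i = 1 then k else 0
  mem b a := if b = 0 ∧ ∃ i j : Fin n, a = (i : ℕ) * n + (j : ℕ) ∧ G.Adj i j then 1 else 0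

/-- The answer that is read off the final state: "NO" if register `0` holds `0`; otherwise
register `1` holds the length `l` of a list of vertex sets, and the vertex `v` belongs to the `c`-th
of them (`c < l`) if the cell of bank `1` at the address `c * n + v` is not `0`. -/
def output (n : ℕ) (s : State) : Option (Finset (Finset (Fin n))) :=
  if s.reg 0 = 0 then none
  else some ((Finset.range (s.reg 1)).image fun c =>
    Finset.univ.filter fun v : Fin n => s.mem 1 (c * n + (v : ℕ)) ≠ 0)

end EdgeCliqueCover

/-!
The program is a branching algorithm. Suppose that some cliques have been fixed, and that `R` is a
set of vertices such that every edge with an end outside `R` is covered by them. If `v` is a vertex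
of `R` with at most `d` neighbours in `R` and `vw` is an uncovered edge with `w ∈ R`, then the next
clique may be assumed to contain `v` and `w` and to lie inside `R`: otherwise intersect it with `R`
(`Node.Extends.new_add`). Removing vertices of minimum degree one by one, as long as all their edges
inside the rest are covered, leads either to such an edge `vw` or to the conclusion that all edges
are covered (`ensures_peel`). So it remains to choose the rest of the clique among the at most `d`
candidates in the neighbourhood of `v`.

This choice is made by branching. If `v` is a candidate, then some clique that is to be found
contains `v` or a candidate that is not adjacent to `v` (`Node.Extends.exists_add`). Take `v` with
the fewest such non-neighbours, say `s` of them including `v` itself. Each of the `s` branches then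
discards at least `s` candidates, and since `s ≤ 3 ^ (s / 3) ≤ 1.4423 ^ s`, at most
`1.4423 ^ d` branches result for each of the `k` cliques (`Node.mul_weight_add_le`). The search tree
has polynomial height and hence at most `1.4423 ^ (d * k) * n ^ O(1)` nodes, provided that `k` is
first replaced by `min k (n * n)`, which does not change the answer (`HasCover.min`).

The search tree is traversed with an explicit stack in the memory. The invariant `StackInv` says
that an extendable node is on the stack if there is any solution, and that the total weight of the
stack is bounded by the number of remaining iterations; the weight `Node.weight` of a node bounds
the size of the search tree below it.

The running time is estimated in two stages. `Ensures` is a program logic for total correctness in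
which each instruction costs one step, and in which the number of steps of nested `for`-loops is
computed from the text of the program (`Prog.budget`). `Steps.run` passes to logarithmic cost: in
the programs considered the numbers grow by at most one per step, so that the bit lengths remain
polynomial in `n` although the number of steps is exponential.
-/

namespace EdgeCliqueCover

/-! ### Unit-cost runs of programs -/

/-- The state `s` with `v` written into register `i`. -/
def State.setReg (s : State) (i v : ℕ) : State := ⟨Function.update s.reg i v, s.mem⟩

/-- The state `s` with `v` written into the cell `a` of bank `b`. -/
def State.setMem (s : State) (b a v : ℕ) : State :=
  ⟨s.reg, Function.update s.mem b (Function.update (s.mem b) a v)⟩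

@[simp] theorem State.reg_setReg (s : State) (i v j : ℕ) :
    (s.setReg i v).reg j = if j = i then v else s.reg j := by
  simp [State.setReg, Function.update_apply]

@[simp] theorem State.mem_setReg (s : State) (i v : ℕ) : (s.setReg i v).mem = s.mem := rfl

@[simp] theorem State.reg_setMem (s : State) (b a v : ℕ) : (s.setMem b a v).reg = s.reg := rfl

@[simp] theorem State.mem_setMem (s : State) (b a v b' : ℕ) :
    (s.setMem b a v).mem b' = if b' = b then Function.update (s.mem b) a v else s.mem b' := by
  simp only [State.setMem, Function.update_apply]

/-- `Steps p s s' m`: started in `s`, the program `p` halts in `s'` after `m` elementary steps (each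
executed instruction and each evaluated test is one step, whatever the numbers involved). -/
inductive Steps : Prog → State → State → ℕ → Prop
  | skip (s : State) : Steps .skip s s 1
  | assign (i : ℕ) (e : Expr) (s : State) : Steps (.assign i e) s (s.setReg i (e.eval s)) 1
  | store (b : ℕ) (a e : Expr) (s : State) :
      Steps (.store b a e) s (s.setMem b (a.eval s) (e.eval s)) 1
  | seq {p q : Prog} {s s₁ s₂ : State} {m₁ m₂ : ℕ} :
      Steps p s s₁ m₁ → Steps q s₁ s₂ m₂ → Steps (.seq p q) s s₂ (m₁ + m₂)
  | cond_true {e : Expr} {p q : Prog} {s s₁ : State} {m : ℕ} :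
      e.eval s ≠ 0 → Steps p s s₁ m → Steps (.cond e p q) s s₁ (m + 1)
  | cond_false {e : Expr} {p q : Prog} {s s₁ : State} {m : ℕ} :
      e.eval s = 0 → Steps q s s₁ m → Steps (.cond e p q) s s₁ (m + 1)
  | loop_true {e : Expr} {p : Prog} {s s₁ s₂ : State} {m₁ m₂ : ℕ} :
      e.eval s ≠ 0 → Steps p s s₁ m₁ → Steps (.loop e p) s₁ s₂ m₂ →
        Steps (.loop e p) s s₂ (m₁ + m₂ + 1)
  | loop_false {e : Expr} {p : Prog} {s : State} : e.eval s = 0 → Steps (.loop e p) s s 1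

/-! ### From unit cost to logarithmic cost -/

/-- `e.width` times the bit length of the numbers in a state bounds the bit length of `e`. -/
def Expr.width : Expr → ℕ
  | .const _ => 1
  | .reg _ => 1
  | .mem _ _ => 1
  | .op _ e₁ e₂ => e₁.width + e₂.width

/-- `e.charge` times the bit length of the numbers in a state bounds the cost of `e`. -/
def Expr.charge : Expr → ℕ
  | .const _ => 1
  | .reg _ => 1
  | .mem _ e => e.charge + e.width + 1
  | .op _ e₁ e₂ => e₁.charge + e₂.charge + e₁.width + e₂.width

/-- `e` reads only registers that satisfy `Z`, and its constants are `0` and `1`. -/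
def Expr.reads (Z : ℕ → Bool) : Expr → Bool
  | .const c => decide (c ≤ 1)
  | .reg i => Z i
  | .mem _ e => e.reads Z
  | .op _ e₁ e₂ => e₁.reads Z && e₂.reads Z

/-- The value of `e` is at most the largest number in the state. -/
def Expr.nonIncreasing : Expr → Bool
  | .op .add _ _ => false
  | .op .mul _ _ => false
  | .op .sub e _ => e.nonIncreasing
  | .op .div e _ => e.nonIncreasing
  | _ => true

/-- The value of `e` exceeds the largest number in the state by at most `1`. -/
def Expr.slow : Expr → Bool
  | .op .add e (.const _) => e.nonIncreasing
  | e => e.nonIncreasing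

/-- A program that reads only registers satisfying `Z`, writes only slowly growing values, and whose
expressions have total charge at most `K` per step. Products may be used in addresses and in
tests. -/
def Prog.tame (Z : ℕ → Bool) (K : ℕ) : Prog → Bool
  | .skip => true
  | .assign _ e => e.reads Z && e.slow && decide (e.charge + e.width ≤ K)
  | .store _ a e => a.reads Z && e.reads Z && e.slow &&
      decide (a.charge + e.charge + a.width + e.width ≤ K)
  | .seq p q => p.tame Z K && q.tame Z K
  | .cond e p q => e.reads Z && decide (e.charge + e.width ≤ K) && p.tame Z K && q.tame Z K
  | .loop e p => e.reads Z && decide (e.charge + e.width ≤ K) && p.tame Z K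

/-- All memory cells, and all registers satisfying `Z`, hold numbers that are at most `B`. -/
def State.BoundedBy (Z : ℕ → Bool) (B : ℕ) (s : State) : Prop :=
  (∀ i, Z i → s.reg i ≤ B) ∧ ∀ b a, s.mem b a ≤ B

theorem Expr.one_le_width (e : Expr) : 1 ≤ e.width := by
  induction e with
  | op o e₁ e₂ h₁ h₂ => simp only [Expr.width]; omega
  | _ => simp [Expr.width]

theorem len_le {x w L : ℕ} (hw : 1 ≤ w) (hx : x < 2 ^ (w * L)) : len x ≤ w * (L + 1) := by
  have := Nat.size_le.2 hx
  unfold len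
  nlinarith

theorem Op.eval_lt (o : Op) {x y v w : ℕ} (hv : 1 ≤ v) (hw : 1 ≤ w) (hx : x < 2 ^ v)
    (hy : y < 2 ^ w) : o.eval x y < 2 ^ (v + w) := by
  have h1 : 2 ^ 1 ≤ 2 ^ v := Nat.pow_le_pow_right (by norm_num) hv
  have h2 : 2 ^ 1 ≤ 2 ^ w := Nat.pow_le_pow_right (by norm_num) hw
  rw [pow_add]
  cases o with
  | add => simp only [Op.eval]; nlinarith
  | sub => simp only [Op.eval]; have := Nat.sub_le x y; nlinarith
  | mul => simp only [Op.eval]; exact Nat.mul_lt_mul'' hx hy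
  | div => simp only [Op.eval]; have := Nat.div_le_self x y; nlinarith
  | eq => simp only [Op.eval]; split_ifs <;> nlinarith
  | lt => simp only [Op.eval]; split_ifs <;> nlinarith

@[simp] theorem Op.eval_lt_eq_zero (x y : ℕ) : Op.lt.eval x y = 0 ↔ y ≤ x := by
  simp [Op.eval]

@[simp] theorem Op.eval_eq_eq_zero (x y : ℕ) : Op.eq.eval x y = 0 ↔ x ≠ y := by
  simp [Op.eval]

@[simp] theorem Op.eval_mul_eq_zero (x y : ℕ) : Op.mul.eval x y = 0 ↔ x = 0 ∨ y = 0 := by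
  simp [Op.eval]

theorem Expr.eval_lt {Z : ℕ → Bool} {B L : ℕ} {s : State} (hs : s.BoundedBy Z B) (hB : 1 ≤ B)
    (hL : B < 2 ^ L) (e : Expr) (he : e.reads Z) : e.eval s < 2 ^ (e.width * L) := by
  have hL1 : 1 ≤ L := by
    rcases Nat.eq_zero_or_pos L with rfl | h
    · simp at hL; omega
    · exact h
  induction e with
  | const c =>
    simp only [Expr.reads, decide_eq_true_eq] at he
    simp only [Expr.eval, Expr.width, one_mul]
    omega
  | reg i => simpa [Expr.eval, Expr.width] using (hs.1 i he).trans_lt hL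
  | mem b e _ => simpa [Expr.eval, Expr.width] using (hs.2 b _).trans_lt hL
  | op o e₁ e₂ h₁ h₂ =>
    simp only [Expr.reads, Bool.and_eq_true] at he
    simp only [Expr.eval, Expr.width, add_mul]
    exact o.eval_lt (Nat.mul_pos e₁.one_le_width hL1) (Nat.mul_pos e₂.one_le_width hL1)
      (h₁ he.1) (h₂ he.2)

theorem Expr.len_eval_le {Z : ℕ → Bool} {B L : ℕ} {s : State} (hs : s.BoundedBy Z B) (hB : 1 ≤ B)
    (hL : B < 2 ^ L) (e : Expr) (he : e.reads Z) : len (e.eval s) ≤ e.width * (L + 1) :=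
  len_le e.one_le_width (e.eval_lt hs hB hL he)

theorem Expr.cost_le {Z : ℕ → Bool} {B L : ℕ} {s : State} (hs : s.BoundedBy Z B) (hB : 1 ≤ B)
    (hL : B < 2 ^ L) (e : Expr) (he : e.reads Z) : e.cost s ≤ e.charge * (L + 1) := by
  induction e with
  | const c => exact Expr.len_eval_le hs hB hL _ he
  | reg i => exact Expr.len_eval_le hs hB hL (.reg i) he
  | mem b e h =>
    have h₁ := e.len_eval_le hs hB hL he
    have h₂ : len (s.mem b (e.eval s)) ≤ 1 * (L + 1) :=
      len_le le_rfl (by simpa using (hs.2 b _).trans_lt hL)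
    have h₃ := h he
    simp only [Expr.cost, Expr.charge, add_mul]
    linarith
  | op o e₁ e₂ h₁ h₂ =>
    simp only [Expr.reads, Bool.and_eq_true] at he
    have h₃ := e₁.len_eval_le hs hB hL he.1
    have h₄ := e₂.len_eval_le hs hB hL he.2
    have h₅ := h₁ he.1
    have h₆ := h₂ he.2
    simp only [Expr.cost, Expr.charge, add_mul]
    linarith

theorem Expr.eval_le_of_nonIncreasing {Z : ℕ → Bool} {B : ℕ} {s : State} (hs : s.BoundedBy Z B)
    (hB : 1 ≤ B) (e : Expr) (he : e.reads Z) (h : e.nonIncreasing) : e.eval s ≤ B := by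
  induction e with
  | const c => simp only [Expr.reads, decide_eq_true_eq] at he; simp only [Expr.eval]; omega
  | reg i => exact hs.1 i he
  | mem b e _ => exact hs.2 b _
  | op o e₁ e₂ h₁ h₂ =>
    simp only [Expr.reads, Bool.and_eq_true] at he
    cases o with
    | add => simp [Expr.nonIncreasing] at h
    | mul => simp [Expr.nonIncreasing] at h
    | sub => exact (Nat.sub_le _ _).trans (h₁ he.1 h)
    | div => exact (Nat.div_le_self _ _).trans (h₁ he.1 h)
    | eq => simp only [Expr.eval, Op.eval]; split_ifs <;> omega
    | lt => simp only [Expr.eval, Op.eval]; split_ifs <;> omega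

theorem Expr.eval_le_of_slow {Z : ℕ → Bool} {B : ℕ} {s : State} (hs : s.BoundedBy Z B)
    (hB : 1 ≤ B) (e : Expr) (he : e.reads Z) (h : e.slow) : e.eval s ≤ B + 1 := by
  unfold Expr.slow at h
  split at h
  · simp only [Expr.reads, Bool.and_eq_true, decide_eq_true_eq] at he
    exact Nat.add_le_add (Expr.eval_le_of_nonIncreasing hs hB _ he.1 h) he.2
  · exact (Expr.eval_le_of_nonIncreasing hs hB _ he h).trans (Nat.le_succ _)

theorem State.BoundedBy.mono {Z : ℕ → Bool} {B B' : ℕ} {s : State} (hs : s.BoundedBy Z B)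
    (h : B ≤ B') : s.BoundedBy Z B' :=
  ⟨fun i hi => (hs.1 i hi).trans h, fun b a => (hs.2 b a).trans h⟩

/-- In a tame program the numbers grow by at most `1` per step, so that `m` steps cost at most
`K * m` times the bit length of `B + m`, where `B` bounds the numbers in the initial state. -/
theorem Steps.run {Z : ℕ → Bool} {K L : ℕ} (hK : 1 ≤ K) {p : Prog} {s s' : State} {m : ℕ}
    (h : Steps p s s' m) : ∀ {B : ℕ}, p.tame Z K → s.BoundedBy Z B → 1 ≤ B → B + m < 2 ^ L →
      ∃ t, Run p s s' t ∧ t ≤ K * m * (L + 1) ∧ s'.BoundedBy Z (B + m) := by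
  induction h with
  | skip s =>
    intro B _ hs hB hL
    exact ⟨1, .skip s, by nlinarith [Nat.zero_le (K * L)], hs.mono (Nat.le_succ _)⟩
  | assign i e s =>
    intro B hp hs hB hL
    simp only [Prog.tame, Bool.and_eq_true, decide_eq_true_eq] at hp
    obtain ⟨⟨h₁, h₂⟩, h₃⟩ := hp
    have hL' : B < 2 ^ L := by omega
    refine ⟨_, .assign i e s, ?_, ?_, ?_⟩
    · have h₄ := e.len_eval_le hs hB hL' h₁
      have h₅ := e.cost_le hs hB hL' h₁
      nlinarith [Nat.mul_le_mul_right (L + 1) h₃]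
    · intro j hj
      by_cases hji : j = i
      · simpa [hji, State.setReg] using e.eval_le_of_slow hs hB h₁ h₂
      · simpa [hji, State.setReg] using (hs.1 j hj).trans (Nat.le_succ B)
    · intro b a; exact (hs.2 b a).trans (Nat.le_succ B)
  | store b a e s =>
    intro B hp hs hB hL
    simp only [Prog.tame, Bool.and_eq_true, decide_eq_true_eq] at hp
    obtain ⟨⟨⟨h₀, h₁⟩, h₂⟩, h₃⟩ := hp
    have hL' : B < 2 ^ L := by omega
    refine ⟨_, .store b a e s, ?_, ?_, ?_⟩
    · have h₄ := e.len_eval_le hs hB hL' h₁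
      have h₅ := e.cost_le hs hB hL' h₁
      have h₆ := a.len_eval_le hs hB hL' h₀
      have h₇ := a.cost_le hs hB hL' h₀
      nlinarith [Nat.mul_le_mul_right (L + 1) h₃]
    · intro j hj; exact (hs.1 j hj).trans (Nat.le_succ B)
    · intro c x
      have h₈ := (hs.2 c x).trans (Nat.le_succ B)
      have h₉ := e.eval_le_of_slow hs hB h₁ h₂
      by_cases hcb : c = b
      · subst hcb
        by_cases hx : x = a.eval s
        · simpa [State.setMem, hx] using h₉
        · simpa [State.setMem, hx] using h₈
      · simpa [State.setMem, hcb] using h₈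
  | seq h₁ h₂ ih₁ ih₂ =>
    intro B hp hs hB hL
    simp only [Prog.tame, Bool.and_eq_true] at hp
    obtain ⟨t₁, r₁, c₁, b₁⟩ := ih₁ hp.1 hs hB (by omega)
    obtain ⟨t₂, r₂, c₂, b₂⟩ := ih₂ hp.2 b₁ (by omega) (by omega)
    refine ⟨_, .seq r₁ r₂, ?_, by rwa [← add_assoc]⟩
    rw [mul_add K, add_mul]; omega
  | cond_true h _ ih =>
    intro B hp hs hB hL
    simp only [Prog.tame, Bool.and_eq_true, decide_eq_true_eq] at hp
    obtain ⟨⟨⟨h₁, h₂⟩, h₃⟩, h₄⟩ := hp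
    obtain ⟨t₁, r₁, c₁, b₁⟩ := ih h₃ hs hB (by omega)
    refine ⟨_, .cond_true h r₁, ?_, b₁.mono (by omega)⟩
    have hL' : B < 2 ^ L := by omega
    have h₅ := Expr.len_eval_le hs hB hL' _ h₁
    have h₆ := Expr.cost_le hs hB hL' _ h₁
    nlinarith [Nat.mul_le_mul_right (L + 1) h₂]
  | cond_false h _ ih =>
    intro B hp hs hB hL
    simp only [Prog.tame, Bool.and_eq_true, decide_eq_true_eq] at hp
    obtain ⟨⟨⟨h₁, h₂⟩, h₃⟩, h₄⟩ := hp
    obtain ⟨t₁, r₁, c₁, b₁⟩ := ih h₄ hs hB (by omega)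
    refine ⟨_, .cond_false h r₁, ?_, b₁.mono (by omega)⟩
    have hL' : B < 2 ^ L := by omega
    have h₅ := Expr.len_eval_le hs hB hL' _ h₁
    have h₆ := Expr.cost_le hs hB hL' _ h₁
    nlinarith [Nat.mul_le_mul_right (L + 1) h₂]
  | loop_true h _ _ ih₁ ih₂ =>
    intro B hp hs hB hL
    have hp' := hp
    simp only [Prog.tame, Bool.and_eq_true, decide_eq_true_eq] at hp
    obtain ⟨⟨h₁, h₂⟩, h₃⟩ := hp
    obtain ⟨t₁, r₁, c₁, b₁⟩ := ih₁ h₃ hs hB (by omega)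
    obtain ⟨t₂, r₂, c₂, b₂⟩ := ih₂ hp' b₁ (by omega) (by omega)
    refine ⟨_, .loop_true h r₁ r₂, ?_, b₂.mono (by omega)⟩
    have hL' : B < 2 ^ L := by omega
    have h₅ := Expr.len_eval_le hs hB hL' _ h₁
    have h₆ := Expr.cost_le hs hB hL' _ h₁
    nlinarith [Nat.mul_le_mul_right (L + 1) h₂]
  | loop_false h =>
    intro B hp hs hB hL
    simp only [Prog.tame, Bool.and_eq_true, decide_eq_true_eq] at hp
    obtain ⟨⟨h₁, h₂⟩, h₃⟩ := hp
    refine ⟨_, .loop_false h, ?_, hs.mono (by omega)⟩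
    have hL' : B < 2 ^ L := by omega
    have h₅ := Expr.len_eval_le hs hB hL' _ h₁
    have h₆ := Expr.cost_le hs hB hL' _ h₁
    nlinarith [Nat.mul_le_mul_right (L + 1) h₂]

/-! ### Program logic -/

/-- The registers that a program writes. -/
def Prog.wregs : Prog → List ℕ
  | .skip => []
  | .assign i _ => [i]
  | .store _ _ _ => []
  | .seq p q => p.wregs ++ q.wregs
  | .cond _ p q => p.wregs ++ q.wregs
  | .loop _ p => p.wregs

/-- The memory banks that a program writes. -/
def Prog.wbanks : Prog → List ℕ
  | .skip => []
  | .assign _ _ => []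
  | .store b _ _ => [b]
  | .seq p q => p.wbanks ++ q.wbanks
  | .cond _ p q => p.wbanks ++ q.wbanks
  | .loop _ p => p.wbanks

/-- `s'` differs from `s` at most in the registers and banks that `p` writes. -/
structure Prog.Frame (p : Prog) (s s' : State) : Prop where
  reg : ∀ i, i ∉ p.wregs → s'.reg i = s.reg i
  mem : ∀ b, b ∉ p.wbanks → s'.mem b = s.mem b

theorem Steps.frame {p : Prog} {s s' : State} {m : ℕ} (h : Steps p s s' m) : p.Frame s s' := by
  induction h with
  | skip => exact ⟨fun _ _ => rfl, fun _ _ => rfl⟩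
  | assign i e s =>
    refine ⟨fun j hj => ?_, fun _ _ => rfl⟩
    simp only [Prog.wregs, List.mem_singleton] at hj
    simp [hj]
  | store b a e s =>
    refine ⟨fun _ _ => rfl, fun c hc => ?_⟩
    simp only [Prog.wbanks, List.mem_singleton] at hc
    simp [hc]
  | seq _ _ ih₁ ih₂ =>
    refine ⟨fun j hj => ?_, fun b hb => ?_⟩
    · simp only [Prog.wregs, List.mem_append, not_or] at hj
      rw [ih₂.reg j hj.2, ih₁.reg j hj.1]
    · simp only [Prog.wbanks, List.mem_append, not_or] at hb
      rw [ih₂.mem b hb.2, ih₁.mem b hb.1]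
  | cond_true _ _ ih =>
    refine ⟨fun j hj => ?_, fun b hb => ?_⟩
    · simp only [Prog.wregs, List.mem_append, not_or] at hj
      exact ih.reg j hj.1
    · simp only [Prog.wbanks, List.mem_append, not_or] at hb
      exact ih.mem b hb.1
  | cond_false _ _ ih =>
    refine ⟨fun j hj => ?_, fun b hb => ?_⟩
    · simp only [Prog.wregs, List.mem_append, not_or] at hj
      exact ih.reg j hj.2
    · simp only [Prog.wbanks, List.mem_append, not_or] at hb
      exact ih.mem b hb.2
  | loop_true _ _ _ ih₁ ih₂ =>
    exact ⟨fun j hj => (ih₂.reg j hj).trans (ih₁.reg j hj),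
      fun b hb => (ih₂.mem b hb).trans (ih₁.mem b hb)⟩
  | loop_false => exact ⟨fun _ _ => rfl, fun _ _ => rfl⟩

/-- The number of steps that a program takes at most if each loop in it is repeated at most `N`
times whenever it is entered. -/
def Prog.budget (N : ℕ) : Prog → ℕ
  | .skip => 1
  | .assign _ _ => 1
  | .store _ _ _ => 1
  | .seq p q => p.budget N + q.budget N
  | .cond _ p q => p.budget N + q.budget N + 1
  | .loop _ p => N * (p.budget N + 1) + 1

/-- The coefficient in the polynomial bound `Prog.budget_le`. -/
def Prog.size : Prog → ℕ
  | .skip => 1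
  | .assign _ _ => 1
  | .store _ _ _ => 1
  | .seq p q => p.size + q.size
  | .cond _ p q => p.size + q.size + 1
  | .loop _ p => p.size + 1

/-- The nesting depth of the loops. -/
def Prog.depth : Prog → ℕ
  | .skip => 0
  | .assign _ _ => 0
  | .store _ _ _ => 0
  | .seq p q => max p.depth q.depth
  | .cond _ p q => max p.depth q.depth
  | .loop _ p => p.depth + 1

theorem Prog.budget_le (N : ℕ) (p : Prog) : p.budget N ≤ p.size * (N + 1) ^ p.depth := by
  have key : ∀ {x D D' : ℕ} (S : ℕ), D ≤ D' → x ≤ S * (N + 1) ^ D → x ≤ S * (N + 1) ^ D' :=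
    fun S hD hx => hx.trans (Nat.mul_le_mul_left _ (Nat.pow_le_pow_right (by omega) hD))
  induction p with
  | skip => simp [Prog.budget, Prog.size, Prog.depth]
  | assign => simp [Prog.budget, Prog.size, Prog.depth]
  | store => simp [Prog.budget, Prog.size, Prog.depth]
  | seq p q h₁ h₂ =>
    simp only [Prog.budget, Prog.size, Prog.depth, add_mul]
    exact Nat.add_le_add (key _ (le_max_left _ _) h₁) (key _ (le_max_right _ _) h₂)
  | cond e p q h₁ h₂ =>
    simp only [Prog.budget, Prog.size, Prog.depth, add_mul, one_mul]
    exact Nat.add_le_add (Nat.add_le_add (key _ (le_max_left _ _) h₁) (key _ (le_max_right _ _) h₂))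
      (Nat.one_le_pow _ _ (by omega))
  | loop e p h =>
    simp only [Prog.budget, Prog.size, Prog.depth, pow_succ]
    have : 1 ≤ (N + 1) ^ p.depth := Nat.one_le_pow _ _ (by omega)
    nlinarith [Nat.mul_le_mul_left N h, Nat.mul_le_mul_left N this]

/-- Started in `s`, the program `p` halts within its budget in a state that satisfies `Q`. -/
def Ensures (N : ℕ) (p : Prog) (s : State) (Q : State → Prop) : Prop :=
  ∃ s' m, Steps p s s' m ∧ m ≤ p.budget N ∧ Q s'

section Rules

variable {N : ℕ} {p q : Prog} {s : State} {Q R : State → Prop}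

theorem Ensures.mono (h : Ensures N p s Q) (hQ : ∀ s', p.Frame s s' → Q s' → R s') :
    Ensures N p s R := by
  obtain ⟨s', m, h₁, h₂, h₃⟩ := h
  exact ⟨s', m, h₁, h₂, hQ s' h₁.frame h₃⟩

theorem Ensures.skip (h : Q s) : Ensures N .skip s Q := ⟨s, 1, .skip s, le_rfl, h⟩

theorem Ensures.assign {i : ℕ} {e : Expr} (h : Q (s.setReg i (e.eval s))) :
    Ensures N (.assign i e) s Q := ⟨_, 1, .assign i e s, le_rfl, h⟩

theorem Ensures.store {b : ℕ} {a e : Expr} (h : Q (s.setMem b (a.eval s) (e.eval s))) :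
    Ensures N (.store b a e) s Q := ⟨_, 1, .store b a e s, le_rfl, h⟩

theorem Ensures.seq (h : Ensures N p s fun s' => Ensures N q s' Q) :
    Ensures N (.seq p q) s Q := by
  obtain ⟨s₁, m₁, r₁, l₁, s₂, m₂, r₂, l₂, h⟩ := h
  exact ⟨s₂, _, .seq r₁ r₂, Nat.add_le_add l₁ l₂, h⟩

theorem Ensures.cond {e : Expr} (h₁ : e.eval s ≠ 0 → Ensures N p s Q)
    (h₂ : e.eval s = 0 → Ensures N q s Q) : Ensures N (.cond e p q) s Q := by
  by_cases he : e.eval s = 0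
  · obtain ⟨s', m, r, l, h⟩ := h₂ he
    exact ⟨s', _, .cond_false he r, by simp only [Prog.budget]; omega, h⟩
  · obtain ⟨s', m, r, l, h⟩ := h₁ he
    exact ⟨s', _, .cond_true he r, by simp only [Prog.budget]; omega, h⟩

/-- A loop whose variant, bounded by `M` in the beginning, decreases with every repetition. -/
theorem Ensures.steps_loop {e : Expr} (I : ℕ → State → Prop)
    (hstep : ∀ M s', I M s' → e.eval s' ≠ 0 → ∃ M', M = M' + 1 ∧ Ensures N p s' (I M')) (M : ℕ) :
    ∀ {s : State}, I M s →
      ∃ s' m, Steps (.loop e p) s s' m ∧ m ≤ M * (p.budget N + 1) + 1 ∧ e.eval s' = 0 ∧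
        ∃ M', I M' s' := by
  induction M with
  | zero =>
    intro s h
    by_cases he : e.eval s = 0
    · exact ⟨s, 1, .loop_false he, by omega, he, _, h⟩
    · obtain ⟨M', h', -⟩ := hstep _ s h he
      omega
  | succ M ih =>
    intro s h
    by_cases he : e.eval s = 0
    · exact ⟨s, 1, .loop_false he, by omega, he, _, h⟩
    · obtain ⟨M', h', s₁, m₁, r₁, l₁, h₁⟩ := hstep _ s h he
      obtain rfl : M = M' := by omega
      obtain ⟨s₂, m₂, r₂, l₂, h₂, h₃⟩ := ih h₁
      exact ⟨s₂, _, .loop_true he r₁ r₂, by rw [add_mul]; omega, h₂, h₃⟩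

end Rules

/-- Repeat `p` with register `i` running from `0` to the value of register `b`, exclusively. -/
def Prog.forLoop (i b : ℕ) (p : Prog) : Prog :=
  .seq (.assign i (.const 0))
    (.loop (.op .lt (.reg i) (.reg b)) (.seq p (.assign i (.op .add (.reg i) (.const 1)))))

/-- The rule for `for`-loops: `I x` holds after `x` repetitions, and does not depend on the
counter. -/
theorem Ensures.forLoop {N i b : ℕ} {p : Prog} {s : State} {Q : State → Prop}
    (I : ℕ → State → Prop) (hN : s.reg b ≤ N) (hbi : b ≠ i) (hb : b ∉ p.wregs) (hi : i ∉ p.wregs)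
    (hI : ∀ x s' v, I x s' → I x (s'.setReg i v)) (h0 : I 0 s)
    (hstep : ∀ x s', x < s.reg b → s'.reg i = x → (Prog.forLoop i b p).Frame s s' → I x s' →
      Ensures N p s' (I (x + 1)))
    (hend : ∀ s', (Prog.forLoop i b p).Frame s s' → I (s.reg b) s' → Q s') :
    Ensures N (Prog.forLoop i b p) s Q := by
  set n := s.reg b with hn
  have hwr : ∀ j, j ≠ i → j ∉ p.wregs → j ∉ (Prog.forLoop i b p).wregs := by
    intro j h₁ h₂; simp [Prog.forLoop, Prog.wregs, h₁, h₂]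
  let J : ℕ → State → Prop := fun M s' => ∃ x, M = n - x ∧ x ≤ n ∧ s'.reg i = x ∧
    (Prog.forLoop i b p).Frame s s' ∧ I x s'
  have hJ0 : J n (s.setReg i 0) := by
    refine ⟨0, rfl, Nat.zero_le _, by simp, ⟨fun j hj => ?_, fun _ _ => rfl⟩, hI _ _ _ h0⟩
    have : j ≠ i := by
      simp only [Prog.forLoop, Prog.wregs, List.mem_append, List.mem_singleton] at hj; tauto
    simp [this]
  have hJ : ∀ M s', J M s' → (Expr.op .lt (.reg i) (.reg b)).eval s' ≠ 0 → ∃ M', M = M' + 1 ∧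
      Ensures N (.seq p (.assign i (.op .add (.reg i) (.const 1)))) s' (J M') := by
    rintro M s' ⟨x, rfl, hxn, hx, hf, hIx⟩ he
    have h₇ : s'.reg b = n := hf.reg b (hwr b hbi hb)
    have hlt : x < n := by
      simpa only [Expr.eval, ne_eq, Op.eval_lt_eq_zero, hx, h₇, not_le] using he
    refine ⟨n - (x + 1), by omega, .seq ((hstep x s' hlt hx hf hIx).mono ?_)⟩
    intro s₃ hf₃ hI₃
    have h₈ : s₃.reg i = x := (hf₃.reg i hi).trans hx
    refine .assign ⟨x + 1, rfl, hlt, by simp [Expr.eval, Op.eval, h₈], ?_, hI _ _ _ hI₃⟩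
    refine ⟨fun j hj => ?_, fun c hc => ?_⟩
    · have : j ≠ i ∧ j ∉ p.wregs := by
        simp only [Prog.forLoop, Prog.wregs, List.mem_append, List.mem_singleton] at hj; tauto
      simp [this.1, hf₃.reg j this.2, hf.reg j hj]
    · have : c ∉ p.wbanks := by
        simpa [Prog.forLoop, Prog.wbanks] using hc
      simp [hf₃.mem c this, hf.mem c hc]
  obtain ⟨s₂, m₂, r₂, l₂, h₂, M', x, -, h₃, h₄, h₅, h₆⟩ := Ensures.steps_loop J hJ n hJ0
  have h₇ : s₂.reg b = n := h₅.reg b (hwr b hbi hb)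
  have hx : x = n := by
    simp only [Expr.eval, Op.eval_lt_eq_zero, h₄, h₇] at h₂
    omega
  refine ⟨s₂, 1 + m₂, .seq (.assign _ _ _) r₂, ?_, hend _ h₅ (hx ▸ h₆)⟩
  simp only [Prog.forLoop, Prog.budget] at l₂ ⊢
  nlinarith [Nat.mul_le_mul_right (p.budget N + 1 + 1) hN]

/-- A loop that fills consecutive cells of a bank, each possibly depending on its old content. -/
theorem Ensures.fill {N i b B : ℕ} {a e : Expr} {s : State} {Q : State → Prop} (base : ℕ)
    (g : ℕ → ℕ) (hN : s.reg b ≤ N) (hbi : b ≠ i)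
    (h : ∀ x s', x < s.reg b → s'.reg i = x → (∀ r, r ≠ i → s'.reg r = s.reg r) →
      (∀ c, c ≠ B → s'.mem c = s.mem c) → s'.mem B (base + x) = s.mem B (base + x) →
      a.eval s' = base + x ∧ e.eval s' = g x)
    (hQ : ∀ s', (∀ r, r ≠ i → s'.reg r = s.reg r) → (∀ c, c ≠ B → s'.mem c = s.mem c) →
      (∀ x < s.reg b, s'.mem B (base + x) = g x) →
      (∀ y, (∀ x < s.reg b, y ≠ base + x) → s'.mem B y = s.mem B y) → Q s') :
    Ensures N (Prog.forLoop i b (.store B a e)) s Q := by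
  have hfr : ∀ {s'}, (Prog.forLoop i b (.store B a e)).Frame s s' →
      (∀ r, r ≠ i → s'.reg r = s.reg r) ∧ (∀ c, c ≠ B → s'.mem c = s.mem c) := fun hf =>
    ⟨fun r hr => hf.reg r (by simp [Prog.forLoop, Prog.wregs, hr]),
      fun c hc => hf.mem c (by simp [Prog.forLoop, Prog.wbanks, hc])⟩
  refine Ensures.forLoop (fun x s' => (∀ y < x, s'.mem B (base + y) = g y) ∧
    ∀ y, (∀ z < x, y ≠ base + z) → s'.mem B y = s.mem B y) hN hbi (by simp [Prog.wregs])
    (by simp [Prog.wregs]) (fun _ _ _ h => h) (by simp) ?_ ?_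
  · rintro x s' hx hi hf ⟨h₁, h₂⟩
    obtain ⟨h₃, h₄⟩ := hfr hf
    obtain ⟨h₅, h₆⟩ := h x s' hx hi h₃ h₄ (h₂ _ (fun z hz => by omega))
    refine .store ⟨fun y hy => ?_, fun y hy => ?_⟩
    · rcases Nat.lt_succ_iff_lt_or_eq.1 hy with hlt | rfl
      · rw [h₅]
        simp [hlt.ne, h₁ y hlt]
      · rw [h₅]; simp [h₆]
    · rw [h₅]
      simp only [State.mem_setMem, if_true]
      rw [Function.update_of_ne (hy x (by omega))]
      exact h₂ y (fun z hz => hy z (by omega))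
  · rintro s' hf ⟨h₁, h₂⟩
    obtain ⟨h₃, h₄⟩ := hfr hf
    exact hQ s' h₃ h₄ h₁ h₂

/-! ### The search tree -/

/-- A node of the search tree: `j` cliques have been started, the `c`-th of them (`c < j`) is
`rows c`. All but the last one are complete; the last one may still be enlarged by vertices
from `P`. -/
structure Node where
  j : ℕ
  rows : ℕ → Finset ℕ
  P : Finset ℕ

section SearchTree

open Classical in
/-- Enlarge the last clique of a node by the vertex `u`, and keep the candidates adjacent to it. If no
clique has been started, only the irrelevant set `rows 0` is changed. -/
noncomputable def Node.add (H : SimpleGraph ℕ) (σ : Node) (u : ℕ) : Node :=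
  ⟨σ.j, Function.update σ.rows (σ.j - 1) (insert u (σ.rows (σ.j - 1))), σ.P.filter (H.Adj u)⟩

open Classical in
/-- Start a new clique at the vertex `v` with candidates from `R`. -/
noncomputable def Node.new (H : SimpleGraph ℕ) (σ : Node) (R : Finset ℕ) (v : ℕ) : Node :=
  ⟨σ.j + 1, Function.update σ.rows σ.j {v}, R.filter (H.Adj v)⟩

/-- The edge `vw` is contained in one of the cliques of the node. -/
def Node.Covers (σ : Node) (v w : ℕ) : Prop := ∃ c < σ.j, v ∈ σ.rows c ∧ w ∈ σ.rows c

/-- The cliques of the node `σ` can be extended to an edge clique cover of `H` by `k` cliques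
`f 0, …, f (k - 1)`. -/
def Node.Extends (H : SimpleGraph ℕ) (k : ℕ) (σ : Node) : Prop :=
  ∃ f : ℕ → Finset ℕ, (∀ c < k, H.IsClique (f c : Set ℕ)) ∧
    (∀ v w, H.Adj v w → ∃ c < k, v ∈ f c ∧ w ∈ f c) ∧
    (∀ c, c + 1 < σ.j → f c = σ.rows c) ∧
    ∀ c, c + 1 = σ.j → σ.rows c ⊆ f c ∧ f c ⊆ σ.rows c ∪ σ.P

/-- The properties that all nodes of the search tree have. -/
structure Node.Valid (H : SimpleGraph ℕ) (n k : ℕ) (σ : Node) : Prop where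
  le : σ.j ≤ k
  clique : ∀ c < σ.j, H.IsClique (σ.rows c : Set ℕ)
  adj : ∀ c, c + 1 = σ.j → ∀ p ∈ σ.P, ∀ x ∈ σ.rows c, H.Adj p x
  lt : ∀ p ∈ σ.P, p < n
  empty : σ.j = 0 → σ.P = ∅

variable {H : SimpleGraph ℕ} {n k : ℕ} {σ : Node}

theorem Node.Valid.add (h : σ.Valid H n k) {u : ℕ} (hu : u ∈ σ.P) : (σ.add H u).Valid H n k := by
  have hj : 0 < σ.j := Nat.pos_of_ne_zero fun h0 => by simp [h.empty h0] at hu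
  have hrow : ∀ c, c + 1 = σ.j → (σ.add H u).rows c = insert u (σ.rows c) := by
    intro c hc
    obtain rfl : c = σ.j - 1 := by omega
    simp [Node.add]
  refine ⟨h.le, fun c hc => ?_, fun c hc p hp x hx => ?_, fun p hp => ?_,
    fun h0 => absurd h0 hj.ne'⟩
  · by_cases hc' : c + 1 = σ.j
    · rw [hrow c hc', Finset.coe_insert]
      exact (h.clique c hc).insert fun x hx _ => h.adj c hc' u hu x hx
    · have : c ≠ σ.j - 1 := by omega
      simpa [Node.add, this] using h.clique c hc
  · rw [hrow c hc] at hx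
    simp only [Node.add, Finset.mem_filter] at hp
    rcases Finset.mem_insert.1 hx with rfl | hx
    · exact hp.2.symm
    · exact h.adj c hc p hp.1 x hx
  · simp only [Node.add, Finset.mem_filter] at hp
    exact h.lt p hp.1

theorem Node.Valid.new (h : σ.Valid H n k) (hj : σ.j < k) {R : Finset ℕ} (hR : ∀ x ∈ R, x < n)
    (v : ℕ) : (σ.new H R v).Valid H n k := by
  refine ⟨hj, fun c hc => ?_, fun c hc p hp x hx => ?_, fun p hp => ?_,
    fun h0 => by simp [Node.new] at h0⟩
  · by_cases hcj : c = σ.j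
    · subst hcj; simp [Node.new]
    · have : c < σ.j := by simp only [Node.new] at hc; omega
      simpa [Node.new, hcj] using h.clique c this
  · obtain rfl : c = σ.j := by simp only [Node.new] at hc; omega
    simp only [Node.new, Finset.mem_filter, Function.update_self, Finset.mem_singleton] at hp hx
    subst hx; exact hp.2.symm
  · simp only [Node.new, Finset.mem_filter] at hp
    exact hR p hp.1

/-- Branching: if `v` is a candidate, the last clique can be assumed to contain `v` or a candidate
that is not adjacent to `v`, for otherwise it could be enlarged by `v`. -/
theorem Node.Extends.exists_add (hσ : σ.Valid H n k) (h : σ.Extends H k) {v : ℕ} (hv : v ∈ σ.P) :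
    ∃ u ∈ σ.P, ¬ H.Adj v u ∧ (σ.add H u).Extends H k := by
  classical
  have hj : 0 < σ.j := Nat.pos_of_ne_zero fun h0 => by simp [hσ.empty h0] at hv
  obtain ⟨c₀, hc₀⟩ : ∃ c₀, c₀ + 1 = σ.j := ⟨σ.j - 1, by omega⟩
  have hck : c₀ < k := by have := hσ.le; omega
  have hc₀' : σ.j - 1 = c₀ := by omega
  -- it suffices to have a cover whose clique `c₀` contains some `u` as required
  suffices ∃ u ∈ σ.P, ¬ H.Adj v u ∧ ∃ f : ℕ → Finset ℕ, (∀ c < k, H.IsClique (f c : Set ℕ)) ∧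
      (∀ v w, H.Adj v w → ∃ c < k, v ∈ f c ∧ w ∈ f c) ∧ (∀ c, c + 1 < σ.j → f c = σ.rows c) ∧
      σ.rows c₀ ⊆ f c₀ ∧ f c₀ ⊆ σ.rows c₀ ∪ σ.P ∧ u ∈ f c₀ by
    obtain ⟨u, hu, hvu, f, h₁, h₂, h₃, h₄, h₅, h₆⟩ := this
    refine ⟨u, hu, hvu, f, h₁, h₂, fun c hc => ?_, fun c hc => ?_⟩
    · have : c ≠ σ.j - 1 := by simp only [Node.add] at hc; omega
      rw [h₃ c hc]; simp [Node.add, this]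
    · obtain rfl : c = c₀ := by simp only [Node.add] at hc; omega
      simp only [Node.add, hc₀', Function.update_self]
      refine ⟨Finset.insert_subset h₆ h₄, fun x hx => ?_⟩
      by_cases hxu : x = u
      · simp [hxu]
      · have := h₁ c hck h₆ hx (Ne.symm hxu)
        have := h₅ hx
        simp only [Finset.mem_union, Finset.mem_insert, Finset.mem_filter] at this ⊢
        tauto
  obtain ⟨f, h₁, h₂, h₃, h₄⟩ := h
  obtain ⟨h₄, h₅⟩ := h₄ c₀ hc₀
  by_cases hex : ∃ u ∈ σ.P, ¬ H.Adj v u ∧ u ∈ f c₀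
  · obtain ⟨u, hu, hvu, huf⟩ := hex
    exact ⟨u, hu, hvu, f, h₁, h₂, h₃, h₄, h₅, huf⟩
  · push Not at hex
    have hsub : ∀ c, f c ⊆ Function.update f c₀ (insert v (f c₀)) c := by
      intro c
      by_cases hc : c = c₀
      · subst hc; simp
      · simp [hc]
    refine ⟨v, hv, H.irrefl, Function.update f c₀ (insert v (f c₀)), fun c hc => ?_,
      fun x y hxy => ?_, fun c hc => ?_, h₄.trans (hsub c₀), ?_, by simp⟩
    · by_cases hcc : c = c₀
      · subst hcc
        rw [Function.update_self, Finset.coe_insert]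
        refine (h₁ c hck).insert fun x hx _ => ?_
        rcases Finset.mem_union.1 (h₅ hx) with hx' | hx'
        · exact hσ.adj c hc₀ v hv x hx'
        · by_contra hn
          exact hex x hx' hn hx
      · simpa [hcc] using h₁ c hc
    · obtain ⟨c, hc, hx, hy⟩ := h₂ x y hxy
      exact ⟨c, hc, hsub c hx, hsub c hy⟩
    · have : c ≠ c₀ := by omega
      simpa [this] using h₃ c hc
    · rw [Function.update_self]
      exact Finset.insert_subset (Finset.mem_union_right _ hv) h₅

/-- Starting a new clique: if every edge that is not inside `R` is covered, then the next clique
can be assumed to be a subset of `R` and to contain a given uncovered edge `vw`. -/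
theorem Node.Extends.new_add (h : σ.Extends H k) (hP : σ.P = ∅)
    {R : Finset ℕ} {v w : ℕ}
    (hR : ∀ x y, H.Adj x y → x ∉ R → σ.Covers x y) (hv : v ∈ R) (hw : w ∈ R) (hvw : H.Adj v w)
    (hc : ¬ σ.Covers v w) : σ.j < k ∧ ((σ.new H R v).add H w).Extends H k := by
  classical
  obtain ⟨f, h₁, h₂, h₃, h₄⟩ := h
  have hrow : ∀ c < σ.j, f c = σ.rows c := by
    intro c hcj
    rcases Nat.lt_or_ge (c + 1) σ.j with hlt | hge
    · exact h₃ c hlt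
    · obtain ⟨h₅, h₆⟩ := h₄ c (by omega)
      rw [hP, Finset.union_empty] at h₆
      exact h₆.antisymm h₅
  obtain ⟨c₀, hc₀k, hvc, hwc⟩ := h₂ v w hvw
  have hjc : σ.j ≤ c₀ := by
    by_contra hlt
    push Not at hlt
    exact hc ⟨c₀, hlt, hrow c₀ hlt ▸ hvc, hrow c₀ hlt ▸ hwc⟩
  have hjk : σ.j < k := by omega
  refine ⟨hjk, ?_⟩
  -- interchange the cliques `σ.j` and `c₀`, then restrict the first one to `R`
  set e := Equiv.swap σ.j c₀ with he
  have hek : ∀ c < k, e c < k := by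
    intro c hc
    simp only [he, Equiv.swap_apply_def]
    split_ifs <;> omega
  have hej : ∀ c < σ.j, e c = c := fun c hc => Equiv.swap_apply_of_ne_of_ne (by omega) (by omega)
  have hee : e σ.j = c₀ := Equiv.swap_apply_left _ _
  have hlow : ∀ c < σ.j, Function.update (f ∘ e) σ.j (f c₀ ∩ R) c = σ.rows c := by
    intro c hc
    rw [Function.update_of_ne (by omega), Function.comp_apply, hej c hc, hrow c hc]
  refine ⟨Function.update (f ∘ e) σ.j (f c₀ ∩ R), fun c hc => ?_, fun x y hxy => ?_,
    fun c hc => ?_, fun c hc => ?_⟩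
  · by_cases hcj : c = σ.j
    · rw [hcj, Function.update_self]
      exact (h₁ c₀ hc₀k).subset (by simp)
    · rw [Function.update_of_ne hcj]
      exact h₁ _ (hek c hc)
  · by_cases hcov : σ.Covers x y
    · obtain ⟨c, hc, hx, hy⟩ := hcov
      exact ⟨c, by omega, by rwa [hlow c hc], by rwa [hlow c hc]⟩
    · have hcov' : ¬ σ.Covers y x := fun ⟨c, hc, h, h'⟩ => hcov ⟨c, hc, h', h⟩
      have hxR : x ∈ R := by by_contra hn; exact hcov (hR x y hxy hn)
      have hyR : y ∈ R := by by_contra hn; exact hcov' (hR y x hxy.symm hn)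
      obtain ⟨c, hc, hx, hy⟩ := h₂ x y hxy
      refine ⟨e c, hek c hc, ?_⟩
      by_cases hcc : e c = σ.j
      · have : c = c₀ := by rw [← hee, ← hcc]; simp [he]
        subst this
        rw [hcc, Function.update_self]
        exact ⟨Finset.mem_inter.2 ⟨hx, hxR⟩, Finset.mem_inter.2 ⟨hy, hyR⟩⟩
      · rw [Function.update_of_ne hcc, Function.comp_apply]
        have : e (e c) = c := by simp [he]
        rw [this]; exact ⟨hx, hy⟩
  · simp only [Node.add, Node.new] at hc ⊢
    rw [hlow c (by omega)]
    have h₅ : c ≠ σ.j := by omega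
    simp [h₅]
  · obtain rfl : c = σ.j := by simp only [Node.add, Node.new] at hc; omega
    simp only [Node.add, Node.new, Nat.add_sub_cancel, Function.update_self]
    constructor
    · intro x hx
      simp only [Finset.mem_insert, Finset.mem_singleton] at hx
      rcases hx with rfl | rfl <;> simp [*]
    · intro x hx
      simp only [Finset.mem_inter] at hx
      have hxv := h₁ c₀ hc₀k hvc hx.1
      have hxw := h₁ c₀ hc₀k hwc hx.1
      simp only [Finset.mem_union, Finset.mem_insert, Finset.mem_singleton, Finset.mem_filter]
      by_cases h₅ : x = v
      · exact .inl (.inr h₅)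
      by_cases h₆ : x = w
      · exact .inl (.inl h₆)
      exact .inr ⟨⟨hx.2, hxv (Ne.symm h₅)⟩, hxw (Ne.symm h₆)⟩

/-! ### The size of the search tree -/

/-- The exponential factor of an upper bound on the size of the search tree below `σ`. -/
noncomputable def Node.leaves (d k : ℕ) (σ : Node) : ℝ :=
  (1.4423 : ℝ) ^ ((k - σ.j) * d + σ.P.card)

/-- An upper bound on the height of the search tree below `σ`. -/
def Node.height (n k : ℕ) (σ : Node) : ℕ := (k - σ.j) * (n + 1) + σ.P.card

/-- An upper bound on the number of nodes of the search tree below `σ`. -/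
noncomputable def Node.weight (n k d : ℕ) (σ : Node) : ℝ :=
  σ.leaves d k * (σ.height n k + 1)

theorem natCast_le_pow (s : ℕ) : (s : ℝ) ≤ (1.4423 : ℝ) ^ s := by
  rcases Nat.lt_or_ge s 3 with h | h
  · interval_cases s <;> norm_num
  · induction s, h using Nat.le_induction with
    | base => norm_num
    | succ s hs ih =>
      rw [pow_succ]
      have : (3 : ℝ) ≤ s := by exact_mod_cast hs
      push_cast
      nlinarith

theorem Node.one_le_leaves (d k : ℕ) (σ : Node) : 1 ≤ σ.leaves d k :=
  one_le_pow₀ (by norm_num)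

theorem Node.one_le_weight (n k d : ℕ) (σ : Node) : 1 ≤ σ.weight n k d := by
  have h₁ := σ.one_le_leaves d k
  have h₂ : (0 : ℝ) ≤ σ.height n k := Nat.cast_nonneg _
  unfold Node.weight
  nlinarith

open Classical in
/-- If every candidate has at least `s ≥ 1` non-neighbours among the candidates (itself included),
then `s` children of `σ` weigh less than `σ`, because of `s ≤ 1.4423 ^ s`. -/
theorem Node.mul_weight_add_le {d s : ℕ} {v : ℕ} (hv : v ∈ σ.P)
    (hs : ∀ u ∈ σ.P, s ≤ (σ.P.filter fun x => ¬ H.Adj u x).card) (hs1 : 1 ≤ s) :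
    ∃ W : ℝ, 0 ≤ W ∧ (∀ u ∈ σ.P, (σ.add H u).weight n k d ≤ W) ∧ s * W + 1 ≤ σ.weight n k d := by
  have hsP : s ≤ σ.P.card := (hs v hv).trans (Finset.card_filter_le _ _)
  have hcard : ∀ u ∈ σ.P, (σ.add H u).P.card ≤ σ.P.card - s := by
    intro u hu
    have h₁ := Finset.card_filter_add_card_filter_not (s := σ.P) (H.Adj u)
    have h₂ := hs u hu
    simp only [Node.add]
    omega
  have hh : 1 ≤ σ.height n k := by unfold Node.height; omega
  refine ⟨(1.4423 : ℝ) ^ ((k - σ.j) * d + (σ.P.card - s)) * σ.height n k, by positivity,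
    fun u hu => ?_, ?_⟩
  · have h₁ := hcard u hu
    have h₂ : (σ.add H u).height n k + 1 ≤ σ.height n k := by
      simp only [Node.height]
      have : (σ.add H u).j = σ.j := rfl
      rw [this]; omega
    have h₃ : (((σ.add H u).height n k : ℝ) + 1) ≤ σ.height n k := by exact_mod_cast h₂
    refine mul_le_mul (pow_le_pow_right₀ (by norm_num) ?_) h₃ (by positivity) (by positivity)
    have : (σ.add H u).j = σ.j := rfl
    rw [this]; omega
  · have h₁ := natCast_le_pow s
    have h₂ : (1.4423 : ℝ) ^ ((k - σ.j) * d + σ.P.card)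
        = (1.4423 : ℝ) ^ s * (1.4423 : ℝ) ^ ((k - σ.j) * d + (σ.P.card - s)) := by
      rw [← pow_add]; congr 1; omega
    have h₃ := σ.one_le_leaves d k
    have h₄ : (0 : ℝ) ≤ (1.4423 : ℝ) ^ ((k - σ.j) * d + (σ.P.card - s)) * σ.height n k := by
      positivity
    have h₅ := mul_le_mul_of_nonneg_right h₁ h₄
    unfold Node.weight
    rw [mul_add, mul_one]
    refine add_le_add ?_ h₃
    rw [Node.leaves, h₂, mul_assoc]
    exact h₅

open Classical in
theorem Node.weight_new_add_le {d : ℕ} {R : Finset ℕ} {v : ℕ} (w : ℕ) (hj : σ.j < k)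
    (hRn : ∀ x ∈ R, x < n) (hd : (R.filter (H.Adj v)).card ≤ d) :
    ((σ.new H R v).add H w).weight n k d + 1 ≤ σ.weight n k d := by
  set τ := (σ.new H R v).add H w with hτ
  have hPd : τ.P.card ≤ d := (Finset.card_filter_le _ _).trans hd
  have hPn : τ.P.card ≤ n := by
    have : τ.P ⊆ Finset.range n := by
      intro x hx
      simp only [hτ, Node.add, Node.new, Finset.mem_filter] at hx
      exact Finset.mem_range.2 (hRn x hx.1.1)
    simpa using Finset.card_le_card this
  have hτj : τ.j = σ.j + 1 := rfl
  obtain ⟨r, hr⟩ : ∃ r, k - σ.j = r + 1 := ⟨k - σ.j - 1, by omega⟩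
  have hr' : k - τ.j = r := by omega
  have h₁ : τ.leaves d k ≤ σ.leaves d k := by
    refine pow_le_pow_right₀ (by norm_num) ?_
    rw [hr, hr', add_mul]; omega
  have h₂ : τ.height n k + 1 ≤ σ.height n k := by
    simp only [Node.height]
    rw [hr, hr', add_mul]; omega
  have h₃ : ((τ.height n k : ℝ) + 1) ≤ σ.height n k := by exact_mod_cast h₂
  have h₄ := σ.one_le_leaves d k
  have h₅ := mul_le_mul h₁ h₃ (by positivity) (by positivity)
  unfold Node.weight
  linarith

end SearchTree

/-! ### The program -/

-- Registers: the input and the size `k * n` of the matrix of cliques, the height of the stack, the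
-- number of cliques and the pending vertex of the current node, the flag for success, and the
-- arguments and results of the subprograms. `rN` and `rK` have to be the registers `0` and `1`, which
-- hold the input and the output.
local notation "rN" => 0
local notation "rK" => 1
local notation "rKN" => 4
local notation "rSp" => 5
local notation "rJ" => 6
local notation "rU" => 7
local notation "rRes" => 8
local notation "rBit" => 9
local notation "rMin" => 10
local notation "rV" => 11
local notation "rCnt" => 12
local notation "rFound" => 13
local notation "rCov" => 14
-- Loop counters; nested loops need different ones
local notation "iV" => 15
local notation "iX" => 16
local notation "iRound" => 17
local notation "iW" => 18
local notation "iC" => 19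
local notation "iY" => 20
-- Memory banks: the adjacency matrix, the cliques and the candidates of the current node (the
-- cliques being stored as the output requires), and the stack
local notation "bAdj" => 0
local notation "bRows" => 1
local notation "bP" => 6
local notation "bStackU" => 2
local notation "bStackRows" => 3
local notation "bStackP" => 4
local notation "bStackJ" => 5

/-- The cell `b * n + i` of a bank, where `b` and `i` are registers and `n` is in register `s`. -/
abbrev Expr.cell (bank b s i : ℕ) : Expr :=
  .mem bank (.op .add (.op .mul (.reg b) (.reg s)) (.reg i))

/-- The entry of the adjacency matrix for the vertices in the registers `i` and `j`. -/
abbrev Expr.adj (i j : ℕ) : Expr := .cell bAdj i rN j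

/-- Select the vertex `rV` of the set stored in bank `bP` that has the fewest related vertices in
this set, and put their number into `rMin`; the value of `rBit` says whether related means adjacent
or non-adjacent. If the set is empty, `rMin` becomes `n + 1`. -/
def minSelect : Prog :=
  .seq (.assign rMin (.op .add (.reg rN) (.const 1)))
    (.forLoop iV rN (.cond (.mem bP (.reg iV))
      (.seq (.assign rCnt (.const 0))
        (.seq (.forLoop iX rN
            (.cond (.op .mul (.mem bP (.reg iX)) (.op .eq (.adj iV iX) (.reg rBit)))
              (.assign rCnt (.op .add (.reg rCnt) (.const 1))) .skip))
          (.cond (.op .lt (.reg rCnt) (.reg rMin))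
            (.seq (.assign rMin (.reg rCnt)) (.assign rV (.reg iV))) .skip)))
      .skip))

/-- Put a copy of the current node and of the pending vertex `rU` on the stack. -/
def push : Prog :=
  .seq (.forLoop iY rKN (.store bStackRows
      (.op .add (.op .mul (.reg rSp) (.reg rKN)) (.reg iY)) (.mem bRows (.reg iY))))
  (.seq (.forLoop iY rN (.store bStackP
      (.op .add (.op .mul (.reg rSp) (.reg rN)) (.reg iY)) (.mem bP (.reg iY))))
  (.seq (.store bStackJ (.reg rSp) (.reg rJ))
  (.seq (.store bStackU (.reg rSp) (.reg rU))
    (.assign rSp (.op .add (.reg rSp) (.const 1))))))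

/-- Take a node from the stack and add the pending vertex to its last clique. For the root, which has
no cliques, the truncated difference `rJ - 1` is `0`, and the cell that is written belongs to no
clique. -/
def pop : Prog :=
  .seq (.assign rSp (.op .sub (.reg rSp) (.const 1)))
  (.seq (.assign rJ (.mem bStackJ (.reg rSp)))
  (.seq (.assign rU (.mem bStackU (.reg rSp)))
  (.seq (.forLoop iY rKN (.store bRows (.reg iY) (.cell bStackRows rSp rKN iY)))
  (.seq (.store bRows (.op .add (.op .mul (.op .sub (.reg rJ) (.const 1)) (.reg rN)) (.reg rU))
      (.const 1))
    (.forLoop iY rN (.store bP (.reg iY)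
      (.op .lt (.const 0) (.op .mul (.cell bStackP rSp rN iY) (.adj rU iY)))))))))

/-- For each candidate that is not adjacent to `rV`, put the corresponding child on the stack. -/
def branch : Prog :=
  .forLoop rU rN (.cond (.op .mul (.mem bP (.reg rU)) (.op .eq (.adj rV rU) (.const 0))) push .skip)

/-- Test whether the edge between `rV` and `iW` is covered by the cliques of the current node. -/
def covered : Prog :=
  .seq (.assign rCov (.const 0))
    (.forLoop iC rJ (.cond (.op .mul (.cell bRows iC rN rV) (.cell bRows iC rN iW))
      (.assign rCov (.const 1)) .skip))

/-- Search for an uncovered edge from `rV` to a vertex `rU` of the set stored in bank `bP`. -/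
def scan : Prog :=
  .forLoop iW rN (.cond (.op .mul (.mem bP (.reg iW)) (.adj rV iW))
    (.seq covered (.cond (.reg rCov) .skip
      (.seq (.assign rFound (.const 1)) (.assign rU (.reg iW))))) .skip)

/-- Remove vertices of minimum degree from the graph until the one to be removed is in an uncovered
edge. -/
def peel : Prog :=
  .seq (.forLoop iY rN (.store bP (.reg iY) (.const 1)))
  (.seq (.assign rFound (.const 0))
  (.seq (.assign rBit (.const 1))
    (.forLoop iRound rN (.cond (.reg rFound) .skip
      (.seq minSelect (.seq scan (.cond (.reg rFound) .skip
        (.store bP (.reg rV) (.const 0)))))))))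

/-- Start a new clique at `rV` and put the resulting node on the stack. -/
def startClique : Prog :=
  .cond (.op .lt (.reg rJ) (.reg rK))
    (.seq (.forLoop iY rN (.store bRows (.op .add (.op .mul (.reg rJ) (.reg rN)) (.reg iY))
        (.op .eq (.reg iY) (.reg rV))))
    (.seq (.forLoop iY rN (.store bP (.reg iY)
        (.op .lt (.const 0) (.op .mul (.mem bP (.reg iY)) (.adj rV iY)))))
    (.seq (.assign rJ (.op .add (.reg rJ) (.const 1))) push)))
    .skip

/-- Process one node of the search tree. -/
def processNode : Prog :=
  .seq pop
  (.seq (.assign rBit (.const 0))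
  (.seq minSelect
    (.cond (.op .lt (.reg rN) (.reg rMin))
      (.seq peel (.cond (.reg rFound) startClique
        (.seq (.assign rRes (.const 1)) (.assign rSp (.const 0)))))
      branch)))

/-- Traverse the search tree, starting at the root, and write the answer. -/
def search : Prog :=
  .seq (.assign rSp (.const 1))
  (.seq (.loop (.reg rSp) processNode)
    (.cond (.reg rRes) (.seq (.assign rN (.const 1)) (.assign rK (.reg rJ)))
      (.assign rN (.const 0))))

/-! ### The nodes in the memory -/

/-- The cells of a bank from `off` on hold the rows of a bit matrix with `n` columns, whose `c`-th
row, `c < j`, is the set `rows c`. -/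
def IsRows (A : ℕ → ℕ) (off n j : ℕ) (rows : ℕ → Finset ℕ) : Prop :=
  ∀ c < j, ∀ x < n, A (off + (c * n + x)) ≠ 0 ↔ x ∈ rows c

/-- The cells of a bank from `off` on hold the characteristic vector of the set `P`. -/
def IsSet (A : ℕ → ℕ) (off n : ℕ) (P : Finset ℕ) : Prop :=
  ∀ x < n, A (off + x) ≠ 0 ↔ x ∈ P

/-- The `f`-th entry of the stack is the node `σ` with the pending vertex `u`. -/
structure Stored (m : ℕ → ℕ → ℕ) (n k f : ℕ) (σ : Node) (u : ℕ) : Prop where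
  j : m bStackJ f = σ.j
  u : m bStackU f = u
  rows : IsRows (m bStackRows) (f * (k * n)) n σ.j σ.rows
  P : IsSet (m bStackP) (f * n) n σ.P

/-- The stack of height `sp` holds valid nodes of total weight at most `W`, and if `E` holds then
one of these nodes extends to an edge clique cover. -/
def StackInv (H : SimpleGraph ℕ) (n k d : ℕ) (m : ℕ → ℕ → ℕ) (sp : ℕ) (E : Prop) (W : ℝ) : Prop :=
  ∃ (φ : ℕ → Node) (υ : ℕ → ℕ),
    (∀ f < sp, Stored m n k f (φ f) (υ f) ∧ υ f < n ∧ ((φ f).add H (υ f)).Valid H n k) ∧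
    (E → ∃ f < sp, ((φ f).add H (υ f)).Extends H k) ∧
    ∑ f ∈ Finset.range sp, ((φ f).add H (υ f)).weight n k d ≤ W

open Classical in
/-- The registers and banks that are constant during the search have the right contents, and `N`
bounds the number of repetitions of the `for`-loops. -/
structure Setup (H : SimpleGraph ℕ) (n k N : ℕ) (s : State) : Prop where
  reg_n : s.reg rN = n
  reg_k : s.reg rK = k
  reg_kn : s.reg rKN = k * n
  adj : ∀ v < n, ∀ x < n, s.mem bAdj (v * n + x) = if H.Adj v x then 1 else 0
  n_le : n ≤ N
  k_le : k ≤ N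
  kn_le : k * n ≤ N

/-- The current node is `σ`. -/
structure Working (n : ℕ) (s : State) (σ : Node) : Prop where
  j : s.reg rJ = σ.j
  rows : IsRows (s.mem bRows) 0 n σ.j σ.rows
  P : IsSet (s.mem bP) 0 n σ.P

variable {H : SimpleGraph ℕ} {n k d N : ℕ} {s s' : State} {σ : Node} {m m' : ℕ → ℕ → ℕ}

theorem Setup.frame {p : Prog} (h : Setup H n k N s) (hf : p.Frame s s')
    (h0 : rN ∉ p.wregs := by decide) (h1 : rK ∉ p.wregs := by decide)
    (h4 : rKN ∉ p.wregs := by decide) (hb : bAdj ∉ p.wbanks := by decide) :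
    Setup H n k N s' :=
  ⟨(hf.reg _ h0).trans h.reg_n, (hf.reg _ h1).trans h.reg_k, (hf.reg _ h4).trans h.reg_kn,
    by rw [hf.mem _ hb]; exact h.adj, h.n_le, h.k_le, h.kn_le⟩

theorem Working.frame {p : Prog} (h : Working n s σ) (hf : p.Frame s s')
    (h0 : rJ ∉ p.wregs := by decide) (h1 : bRows ∉ p.wbanks := by decide)
    (h2 : bP ∉ p.wbanks := by decide) : Working n s' σ :=
  ⟨(hf.reg _ h0).trans h.j, by rw [hf.mem _ h1]; exact h.rows, by rw [hf.mem _ h2]; exact h.P⟩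

theorem Setup.congr (h : Setup H n k N s) (hr : ∀ r ≤ 4, s'.reg r = s.reg r)
    (hb : s'.mem bAdj = s.mem bAdj) : Setup H n k N s' :=
  ⟨(hr _ (by omega)).trans h.reg_n, (hr _ (by omega)).trans h.reg_k, (hr _ (by omega)).trans h.reg_kn,
    by rw [hb]; exact h.adj, h.n_le, h.k_le, h.kn_le⟩

theorem Working.setReg (h : Working n s σ) {i v : ℕ} (hi : i ≠ rJ) : Working n (s.setReg i v) σ :=
  ⟨by simp [Ne.symm hi, h.j], h.rows, h.P⟩

open Classical in
theorem Setup.eval_adj (h : Setup H n k N s) {i j : ℕ} (hi : s.reg i < n) (hj : s.reg j < n) :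
    (Expr.adj i j).eval s = if H.Adj (s.reg i) (s.reg j) then 1 else 0 := by
  simpa [Expr.eval, Op.eval, h.reg_n] using h.adj _ hi _ hj

theorem StackInv.frame {p : Prog} {sp : ℕ} {E : Prop} {W : ℝ} (h : StackInv H n k d s.mem sp E W)
    (hf : p.Frame s s') (h2 : bStackU ∉ p.wbanks := by decide)
    (h3 : bStackRows ∉ p.wbanks := by decide) (h4 : bStackP ∉ p.wbanks := by decide)
    (h5 : bStackJ ∉ p.wbanks := by decide) : StackInv H n k d s'.mem sp E W := by
  obtain ⟨φ, υ, h₁, h₂, h₃⟩ := h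
  refine ⟨φ, υ, fun f hf' => ⟨?_, (h₁ f hf').2⟩, h₂, h₃⟩
  obtain ⟨a, b, c, e⟩ := (h₁ f hf').1
  exact ⟨by rwa [hf.mem _ h5], by rwa [hf.mem _ h2], by rwa [hf.mem _ h3], by rwa [hf.mem _ h4]⟩

theorem StackInv.mono {sp : ℕ} {E E' : Prop} {W W' : ℝ} (h : StackInv H n k d m sp E W)
    (hE : E' → E) (hW : W ≤ W') : StackInv H n k d m sp E' W' := by
  obtain ⟨φ, υ, h₁, h₂, h₃⟩ := h
  exact ⟨φ, υ, h₁, fun e => h₂ (hE e), h₃.trans hW⟩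

theorem add_mul_lt {c j n k x : ℕ} (hc : c < j) (hj : j ≤ k) (hx : x < n) : c * n + x < k * n := by
  have : (c + 1) * n ≤ k * n := Nat.mul_le_mul_right n (by omega)
  rw [add_mul] at this
  omega

theorem StackInv.push {sp u : ℕ} {E : Prop} {W : ℝ} (h : StackInv H n k d m sp E W)
    (hσ : (σ.add H u).Valid H n k) (hu : u < n) (hst : Stored m' n k sp σ u)
    (hJ : ∀ f < sp, m' bStackJ f = m bStackJ f) (hU : ∀ f < sp, m' bStackU f = m bStackU f)
    (hR : ∀ a < sp * (k * n), m' bStackRows a = m bStackRows a)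
    (hP : ∀ a < sp * n, m' bStackP a = m bStackP a) :
    StackInv H n k d m' (sp + 1) (E ∨ (σ.add H u).Extends H k)
      (W + (σ.add H u).weight n k d) := by
  obtain ⟨φ, υ, h₁, h₂, h₃⟩ := h
  have hφ : ∀ f < sp, Function.update φ sp σ f = φ f ∧ Function.update υ sp u f = υ f :=
    fun f hf => by simp [hf.ne]
  refine ⟨Function.update φ sp σ, Function.update υ sp u, fun f hf => ?_, ?_, ?_⟩
  · rcases Nat.lt_succ_iff_lt_or_eq.1 hf with hlt | rfl
    · rw [(hφ f hlt).1, (hφ f hlt).2]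
      obtain ⟨⟨a, b, c, e⟩, h₄, h₅⟩ := h₁ f hlt
      refine ⟨⟨by rw [hJ f hlt, a], by rw [hU f hlt, b], fun i hi x hx => ?_, fun x hx => ?_⟩, h₄, h₅⟩
      · rw [hR _ (add_mul_lt hlt le_rfl (add_mul_lt hi h₅.le hx))]
        exact c i hi x hx
      · rw [hP _ (add_mul_lt hlt le_rfl hx)]
        exact e x hx
    · simpa using ⟨hst, hu, hσ⟩
  · rintro (hE | hE)
    · obtain ⟨f, hf, hx⟩ := h₂ hE
      exact ⟨f, by omega, by rwa [(hφ f hf).1, (hφ f hf).2]⟩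
    · exact ⟨sp, by omega, by simpa using hE⟩
  · rw [Finset.sum_range_succ]
    refine add_le_add ((Finset.sum_le_sum fun f hf => ?_).trans h₃) (by simp)
    rw [(hφ f (Finset.mem_range.1 hf)).1, (hφ f (Finset.mem_range.1 hf)).2]

theorem StackInv.pop {sp : ℕ} {E : Prop} {W : ℝ} (h : StackInv H n k d m (sp + 1) E W) :
    ∃ σ u, Stored m n k sp σ u ∧ u < n ∧ (σ.add H u).Valid H n k ∧
      StackInv H n k d m sp (E ∧ ¬ (σ.add H u).Extends H k)
        (W - (σ.add H u).weight n k d) := by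
  obtain ⟨φ, υ, h₁, h₂, h₃⟩ := h
  obtain ⟨a, b, c⟩ := h₁ sp (by omega)
  refine ⟨φ sp, υ sp, a, b, c, φ, υ, fun f hf => h₁ f (by omega), fun ⟨hE, hn⟩ => ?_, ?_⟩
  · obtain ⟨f, hf, hx⟩ := h₂ hE
    rcases Nat.lt_succ_iff_lt_or_eq.1 hf with hlt | rfl
    · exact ⟨f, hlt, hx⟩
    · exact absurd hx hn
  · rw [Finset.sum_range_succ] at h₃
    linarith

/-! ### Correctness of the parts of the program -/

theorem card_filter_lt_succ (T : Finset ℕ) (x : ℕ) :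
    (T.filter (· < x + 1)).card = (T.filter (· < x)).card + if x ∈ T then 1 else 0 := by
  split_ifs with h
  · have : T.filter (· < x + 1) = insert x (T.filter (· < x)) := by
      ext y; simp only [Finset.mem_filter, Finset.mem_insert]
      constructor
      · rintro ⟨h₁, h₂⟩
        by_cases hy : y = x
        · exact .inl hy
        · exact .inr ⟨h₁, by omega⟩
      · rintro (rfl | ⟨h₁, h₂⟩)
        · exact ⟨h, by omega⟩
        · exact ⟨h₁, by omega⟩
    rw [this, Finset.card_insert_of_notMem (by simp)]
  · congr 1
    ext y; simp only [Finset.mem_filter]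
    refine and_congr_right fun hy => ?_
    have : y ≠ x := fun e => h (e ▸ hy)
    omega

theorem filter_lt_eq_self {T : Finset ℕ} (hT : ∀ x ∈ T, x < n) : T.filter (· < n) = T :=
  Finset.filter_true_of_mem hT

theorem IsSet.eval_ne {b : ℕ} {i : ℕ} {S : Finset ℕ} (hS : IsSet (s.mem b) 0 n S)
    (hi : s.reg i < n) : (Expr.mem b (.reg i)).eval s ≠ 0 ↔ s.reg i ∈ S := by
  have := hS _ hi
  rwa [zero_add] at this

open Classical in
theorem ensures_minSelect (hc : Setup H n k N s) {S : Finset ℕ} (hS : IsSet (s.mem bP) 0 n S)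
    (hSn : ∀ x ∈ S, x < n) (r : ℕ → ℕ → Prop)
    (hr : ∀ v < n, ∀ x < n, s.mem bAdj (v * n + x) = s.reg rBit ↔ r v x) :
    Ensures N minSelect s fun s' =>
      (S = ∅ ∧ s'.reg rMin = n + 1) ∨
      (s'.reg rMin ≤ n ∧ s'.reg rV ∈ S ∧ s'.reg rMin = (S.filter (r (s'.reg rV))).card ∧
        ∀ v ∈ S, s'.reg rMin ≤ (S.filter (r v)).card) := by
  refine .seq (.assign ?_)
  refine Ensures.forLoop (fun y s' => ((∀ v ∈ S, y ≤ v) ∧ s'.reg rMin = n + 1) ∨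
      (s'.reg rMin ≤ n ∧ s'.reg rV ∈ S ∧ s'.reg rMin = (S.filter (r (s'.reg rV))).card ∧
        ∀ v ∈ S, v < y → s'.reg rMin ≤ (S.filter (r v)).card)) (by simpa [hc.reg_n] using hc.n_le)
    (by decide) (by decide) (by decide) (fun _ _ _ h => h) ?_ ?_ ?_
  · left; simp [Expr.eval, Op.eval, hc.reg_n]
  · intro y s₁ hy hi hf hI
    have hyn : y < n := by simpa [hc.reg_n] using hy
    have hSet : s₁.mem bP = s.mem bP := hf.mem _ (by decide)
    have hAdj : s₁.mem bAdj = s.mem bAdj := hf.mem _ (by decide)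
    have hn : s₁.reg rN = n := (hf.reg _ (by decide)).trans (by simpa using hc.reg_n)
    have hbit : s₁.reg rBit = s.reg rBit := (hf.reg _ (by decide)).trans (by simp)
    have hyS : (Expr.mem bP (.reg iV)).eval s₁ ≠ 0 ↔ y ∈ S := by
      rw [IsSet.eval_ne (n := n) (S := S) (by rwa [hSet]) (by omega), hi]
    refine .cond (fun he => ?_) (fun he => ?_)
    · have hy' := hyS.1 he
      refine .seq (.assign (.seq ?_))
      refine Ensures.forLoop (fun x s' => s'.reg rCnt = ((S.filter (r y)).filter (· < x)).card)
        (by simpa [hn] using hc.n_le) (by decide) (by decide) (by decide) (fun _ _ _ h => h)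
        (by simp [Expr.eval]) ?_ ?_
      · intro x s₂ hx hix hf₂ hI₂
        have hxn : x < n := by simpa [hn] using hx
        have h₁ : s₂.mem bP = s.mem bP := (hf₂.mem _ (by decide)).trans hSet
        have h₂ : s₂.mem bAdj = s.mem bAdj := (hf₂.mem _ (by decide)).trans hAdj
        have h₃ : s₂.reg rN = n := (hf₂.reg _ (by decide)).trans (by simpa using hn)
        have h₄ : s₂.reg rBit = s.reg rBit := (hf₂.reg _ (by decide)).trans (by simpa using hbit)
        have h₅ : s₂.reg iV = y := (hf₂.reg _ (by decide)).trans (by simpa using hi)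
        have hx' : s.mem bP x ≠ 0 ↔ x ∈ S := by simpa using hS x hxn
        have key : (Expr.op .mul (.mem bP (.reg iX))
            (.op .eq (.adj iV iX) (.reg rBit))).eval s₂ ≠ 0 ↔ x ∈ S.filter (r y) := by
          simp [Expr.eval, Op.eval, h₁, h₂, h₃, h₄, h₅, hix, ← hr y hyn x hxn, ← hx', and_comm]
        rw [card_filter_lt_succ]
        refine .cond (fun he => .assign ?_) (fun he => .skip ?_)
        · rw [if_pos (key.1 he), ← hI₂]
          simp [Expr.eval, Op.eval]
        · rw [if_neg (fun h => key.2 h he)]; exact hI₂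
      · intro s₂ hf₂ hI₂
        have hcnt : s₂.reg rCnt = (S.filter (r y)).card := by
          rw [hI₂]
          congr 1
          refine filter_lt_eq_self fun x hx => ?_
          simpa [hn] using hSn x (Finset.mem_filter.1 hx).1
        have h₁ : s₂.reg rMin = s₁.reg rMin := (hf₂.reg _ (by decide)).trans (by simp)
        have h₂ : s₂.reg rV = s₁.reg rV := (hf₂.reg _ (by decide)).trans (by simp)
        have h₃ : s₂.reg iV = y := (hf₂.reg _ (by decide)).trans (by simpa using hi)
        have hle : (S.filter (r y)).card ≤ n := by
          have : S.filter (r y) ⊆ Finset.range n := fun x hx =>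
            Finset.mem_range.2 (hSn x (Finset.mem_filter.1 hx).1)
          simpa using Finset.card_le_card this
        refine .cond (fun he => .seq (.assign (.assign ?_))) (fun he => .skip ?_)
        · have hlt : s₂.reg rCnt < s₂.reg rMin := by
            simpa only [Expr.eval, ne_eq, Op.eval_lt_eq_zero, not_le] using he
          right
          simp only [Expr.eval, State.reg_setReg]
          norm_num
          rw [h₃, hcnt]
          refine ⟨hle, hy', rfl, fun v hv hvy => ?_⟩
          rcases Nat.lt_or_eq_of_le hvy with hlt' | rfl
          · rcases hI with ⟨h₄, -⟩ | ⟨-, -, -, h₄⟩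
            · exact absurd (h₄ v hv) (by omega)
            · have := h₄ v hv hlt'
              omega
          · exact le_rfl
        · have hge : s₂.reg rMin ≤ s₂.reg rCnt := by
            simpa only [Expr.eval, Op.eval_lt_eq_zero] using he
          rcases hI with ⟨h₄, h₅⟩ | ⟨h₄, h₅, h₆, h₇⟩
          · omega
          · right
            rw [h₁, h₂]
            refine ⟨h₄, h₅, h₆, fun v hv hvy => ?_⟩
            rcases Nat.lt_succ_iff_lt_or_eq.1 hvy with hlt' | rfl
            · exact h₇ v hv hlt'
            · omega
    · have hy' : y ∉ S := fun h => hyS.2 h he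
      refine .skip ?_
      rcases hI with ⟨h₁, h₂⟩ | ⟨h₁, h₂, h₃, h₄⟩
      · refine .inl ⟨fun v hv => ?_, h₂⟩
        have : v ≠ y := fun e => hy' (e ▸ hv)
        have := h₁ v hv
        omega
      · refine .inr ⟨h₁, h₂, h₃, fun v hv hvy => h₄ v hv ?_⟩
        have : v ≠ y := fun e => hy' (e ▸ hv)
        omega
  · intro s' _ hI
    have hn : (s.setReg rMin ((Expr.op .add (.reg rN) (.const 1)).eval s)).reg rN = n := by
      simpa using hc.reg_n
    rw [hn] at hI
    rcases hI with ⟨h₁, h₂⟩ | ⟨h₁, h₂, h₃, h₄⟩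
    · refine .inl ⟨Finset.eq_empty_of_forall_notMem fun v hv => ?_, h₂⟩
      exact absurd (hSn v hv) (by have := h₁ v hv; omega)
    · exact .inr ⟨h₁, h₂, h₃, fun v hv => h₄ v hv (hSn v hv)⟩

theorem ensures_push (hc : Setup H n k N s) (hw : Working n s σ) (hu : s.reg rU < n)
    (hσ : (σ.add H (s.reg rU)).Valid H n k) {E : Prop} {W : ℝ}
    (h : StackInv H n k d s.mem (s.reg rSp) E W) :
    Ensures N push s fun s' => StackInv H n k d s'.mem (s'.reg rSp)
      (E ∨ (σ.add H (s.reg rU)).Extends H k) (W + (σ.add H (s.reg rU)).weight n k d) := by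
  set sp := s.reg rSp with hsp
  refine .seq (.fill (sp * (k * n)) (s.mem bRows) (by simpa [hc.reg_kn] using hc.kn_le) (by decide)
    (fun x s' hx hi hr hm _ => ?_) fun s₁ hr₁ hm₁ hv₁ ho₁ => ?_)
  · simp [Expr.eval, Op.eval, hi, hr, hm, hc.reg_kn, ← hsp]
  refine .seq (.fill (sp * n) (s.mem bP) (by simpa [hr₁, hc.reg_n] using hc.n_le) (by decide)
    (fun x s' hx hi hr hm _ => ?_) fun s₂ hr₂ hm₂ hv₂ ho₂ => ?_)
  · simp [Expr.eval, Op.eval, hi, hr, hm, hr₁, hm₁, hc.reg_n, ← hsp]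
  refine .seq (.store (.seq (.store (.assign ?_))))
  have hspr : s₂.reg rSp = sp := by simp [hr₁, hr₂, hsp]
  simp only [Expr.eval, Op.eval, State.reg_setReg, State.reg_setMem, if_true, State.mem_setReg,
    hspr]
  refine h.push hσ hu ⟨?_, ?_, fun c hcj x hx => ?_, fun x hx => ?_⟩ (fun f hf => ?_)
    (fun f hf => ?_) (fun a ha => ?_) (fun a ha => ?_)
  · simp [hr₁, hr₂, hw.j]
  · simp [hr₁, hr₂]
  · have hlt := add_mul_lt hcj hσ.le hx
    have := hw.rows c hcj x hx
    simp only [State.mem_setMem]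
    norm_num
    rw [hm₂ 3 (by decide), hv₁ _ (by rwa [hc.reg_kn])]
    simpa using this
  · have := hw.P x hx
    simp only [State.mem_setMem]
    norm_num
    rw [hv₂ _ (by rwa [hr₁ 0 (by decide), hc.reg_n])]
    simpa using this
  · simp [hf.ne, hm₁, hm₂]
  · simp [hf.ne, hm₁, hm₂]
  · simp only [State.mem_setMem]
    norm_num
    rw [hm₂ 3 (by decide), ho₁ _ (fun x _ => by omega)]
  · simp only [State.mem_setMem]
    norm_num
    rw [ho₂ _ (fun x _ => by omega), hm₁ 4 (by decide)]

open Classical in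
theorem ensures_branch (hc : Setup H n k N s) (hw : Working n s σ) (hσ : σ.Valid H n k)
    (hV : s.reg rV ∈ σ.P)
    (hmin : ∀ u ∈ σ.P, (σ.P.filter fun x => ¬ H.Adj (s.reg rV) x).card ≤
      (σ.P.filter fun x => ¬ H.Adj u x).card) {E : Prop} {W : ℝ}
    (h : StackInv H n k d s.mem (s.reg rSp) E W) :
    Ensures N branch s fun s' => StackInv H n k d s'.mem (s'.reg rSp)
      (E ∨ σ.Extends H k) (W + σ.weight n k d - 1) := by
  set v := s.reg rV with hv
  set T := σ.P.filter fun x => ¬ H.Adj v x with hT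
  have hT1 : 1 ≤ T.card := Finset.card_pos.2 ⟨v, Finset.mem_filter.2 ⟨hV, H.irrefl⟩⟩
  obtain ⟨W₀, -, hW₁, hW₂⟩ := Node.mul_weight_add_le (n := n) (k := k) (d := d) hV hmin hT1
  refine Ensures.forLoop (fun x s' => StackInv H n k d s'.mem (s'.reg rSp)
    (E ∨ ∃ u < x, u ∈ T ∧ (σ.add H u).Extends H k) (W + (T.filter (· < x)).card * W₀))
    (by simpa [hc.reg_n] using hc.n_le) (by decide) (by decide) (by decide) (fun _ _ _ h => h)
    (h.mono (by simp) (by simp)) ?_ ?_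
  · intro x s₁ hx hi hf hI
    have hxn : x < n := by rwa [hc.reg_n] at hx
    have hc₁ := hc.frame hf
    have hw₁ := hw.frame hf
    have hv₁ : s₁.reg rV = v := hf.reg _ (by decide)
    have h₁ := hw₁.P.eval_ne (i := rU) (by omega)
    have h₂ := hc₁.eval_adj (i := rV) (j := rU) (by rw [hv₁]; exact hσ.lt v hV) (by omega)
    have key : (Expr.op .mul (.mem bP (.reg rU)) (.op .eq (.adj rV rU) (.const 0))).eval s₁ ≠ 0 ↔
        x ∈ T := by
      rw [Expr.eval, ne_eq, Op.eval_mul_eq_zero, not_or, ← ne_eq, h₁, Expr.eval,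
        Op.eval_eq_eq_zero, not_not, h₂, hv₁, hi, hT, Finset.mem_filter]
      simp [Expr.eval]
    rw [card_filter_lt_succ]
    refine .cond (fun he => ?_) (fun he => .skip (hI.mono ?_ ?_))
    · have hxT := key.1 he
      have hxP := (Finset.mem_filter.1 hxT).1
      refine (ensures_push hc₁ hw₁ (by omega) (by rw [hi]; exact hσ.add hxP) hI).mono ?_
      intro s₂ _ h₃
      rw [hi] at h₃
      refine h₃.mono ?_ ?_
      · rintro (hE | ⟨u, hu, huT, hux⟩)
        · exact .inl (.inl hE)
        · rcases Nat.lt_succ_iff_lt_or_eq.1 hu with hlt | rfl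
          · exact .inl (.inr ⟨u, hlt, huT, hux⟩)
          · exact .inr hux
      · rw [if_pos hxT]
        push_cast
        have := hW₁ x hxP
        linarith
    · rintro (hE | ⟨u, hu, huT, hux⟩)
      · exact .inl hE
      · rcases Nat.lt_succ_iff_lt_or_eq.1 hu with hlt | rfl
        · exact .inr ⟨u, hlt, huT, hux⟩
        · exact absurd he (key.2 huT)
    · rw [if_neg fun h => key.2 h he, add_zero]
  · intro s' _ hI
    rw [hc.reg_n, filter_lt_eq_self fun x hx => hσ.lt x (Finset.mem_filter.1 hx).1] at hI
    refine hI.mono ?_ (by linarith)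
    rintro (hE | hE)
    · exact .inl hE
    · obtain ⟨u, hu, hvu, hx⟩ := hE.exists_add hσ hV
      exact .inr ⟨u, hσ.lt u hu, Finset.mem_filter.2 ⟨hu, hvu⟩, hx⟩

theorem mul_add_eq_iff {c x j u : ℕ} (hx : x < n) (hu : u < n) :
    c * n + x = j * n + u ↔ c = j ∧ x = u := by
  constructor
  · intro h
    have hc : c = j := by
      rcases Nat.lt_trichotomy c j with hlt | rfl | hlt
      · have := add_mul_lt hlt le_rfl hx
        omega
      · rfl
      · have := add_mul_lt hlt le_rfl hu
        omega
    subst hc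
    exact ⟨rfl, by omega⟩
  · rintro ⟨rfl, rfl⟩; rfl

theorem ensures_pop (hc : Setup H n k N s) (hsp : s.reg rSp ≠ 0) {E : Prop} {W : ℝ}
    (h : StackInv H n k d s.mem (s.reg rSp) E W) :
    Ensures N pop s fun s' => ∃ τ : Node, Working n s' τ ∧ τ.Valid H n k ∧
      StackInv H n k d s'.mem (s'.reg rSp) (E ∧ ¬ τ.Extends H k) (W - τ.weight n k d) := by
  classical
  obtain ⟨sp, hsp'⟩ := Nat.exists_eq_succ_of_ne_zero hsp
  rw [hsp'] at h
  obtain ⟨σ, u, hst, hu, hσ, h'⟩ := h.pop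
  suffices Ensures N pop s fun s' => Working n s' (σ.add H u) ∧ s'.reg rSp = sp by
    refine this.mono fun s' hf ⟨h₁, h₂⟩ => ⟨_, h₁, hσ, ?_⟩
    rw [h₂]
    exact h'.frame hf
  have hjk : σ.j ≤ k := hσ.le
  refine .seq (.assign (.seq (.assign (.seq (.assign ?_)))))
  generalize ht : State.setReg _ rU _ = t
  have t5 : t.reg rSp = sp := by subst ht; simp [Expr.eval, Op.eval, hsp']
  have t6 : t.reg rJ = σ.j := by subst ht; simp [Expr.eval, Op.eval, hsp', hst.j]
  have t7 : t.reg rU = u := by subst ht; simp [Expr.eval, Op.eval, hsp', hst.u]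
  have t0 : t.reg rN = n := by subst ht; simp [hc.reg_n]
  have t4 : t.reg rKN = k * n := by subst ht; simp [hc.reg_kn]
  have tm : t.mem = s.mem := by subst ht; rfl
  refine .seq (.fill 0 (fun y => s.mem bStackRows (sp * (k * n) + y))
    (by rw [t4]; exact hc.kn_le) (by decide) (fun x s' hx hi hr hm _ => ?_)
    fun s₁ hr₁ hm₁ hv₁ _ => ?_)
  · simp [Expr.eval, Op.eval, hi, hr, hm, t4, t5, tm]
  refine .seq (.store ?_)
  generalize ht₂ : State.setMem _ _ _ _ = s₂
  have r₂ : s₂.reg = s₁.reg := by subst ht₂; rfl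
  have m₂ : ∀ b, b ≠ 1 → s₂.mem b = s.mem b := fun b hb => by
    subst ht₂; simp [hb, hm₁ b hb, tm]
  have m₂' : s₂.mem bRows = Function.update (s₁.mem bRows) ((σ.j - 1) * n + u) 1 := by
    subst ht₂; simp [Expr.eval, Op.eval, hr₁, t6, t7, t0]
  have hadj : ∀ x < n, s.mem bAdj (u * n + x) = if H.Adj u x then 1 else 0 := hc.adj u hu
  refine .fill 0 (fun x => if 0 < s.mem bStackP (sp * n + x) * s.mem bAdj (u * n + x) then 1 else 0)
    (by rw [r₂, hr₁ 0 (by decide), t0]; exact hc.n_le) (by decide) (fun x s' hx hi hr hm _ => ?_)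
    fun s₃ hr₃ hm₃ hv₃ _ => ⟨⟨?_, fun c hcj x hx => ?_, fun x hx => ?_⟩, ?_⟩
  · simp [Expr.eval, Op.eval, hi, hr, hm, r₂, hr₁, t0, t5, t7, m₂]
  · rw [hr₃ 6 (by decide), r₂, hr₁ 6 (by decide), t6]; rfl
  · rw [zero_add, hm₃ 1 (by decide), m₂']
    have hcj' : c < σ.j := hcj
    have hlt := add_mul_lt hcj' hjk hx
    have h₁ := hv₁ (c * n + x) (by rwa [t4])
    rw [zero_add] at h₁
    have h₂ := hst.rows c hcj' x hx
    by_cases hcx : c = σ.j - 1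
    · subst hcx
      have : (σ.add H u).rows (σ.j - 1) = insert u (σ.rows (σ.j - 1)) := by simp [Node.add]
      simp only [this, Finset.mem_insert, Function.update_apply, mul_add_eq_iff hx hu, h₁, ← h₂]
      by_cases hxu : x = u <;> simp [hxu]
    · have : (σ.add H u).rows c = σ.rows c := by simp [Node.add, hcx]
      simp only [this, Function.update_apply, mul_add_eq_iff hx hu, h₁, ← h₂]
      simp [hcx]
  · rw [hv₃ x (by rwa [r₂, hr₁ 0 (by decide), t0]), hadj x hx]
    have := hst.P x hx
    simp only [Node.add, Finset.mem_filter]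
    rw [← this]
    by_cases hux : H.Adj u x <;> simp [hux, Nat.pos_iff_ne_zero]
  · rw [hr₃ 5 (by decide), r₂, hr₁ 5 (by decide), t5]

/-! ### Finding an uncovered edge -/

theorem ensures_covered (hc : Setup H n k N s) (hj : s.reg rJ = σ.j) (hjk : σ.j ≤ k)
    (hrows : IsRows (s.mem bRows) 0 n σ.j σ.rows) (hV : s.reg rV < n) (hW : s.reg iW < n) :
    Ensures N covered s fun s' => s'.reg rCov ≠ 0 ↔ σ.Covers (s.reg rV) (s.reg iW) := by
  refine .seq (.assign ?_)
  have hj' : (s.setReg rCov ((Expr.const 0).eval s)).reg rJ = σ.j := by simpa using hj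
  refine Ensures.forLoop (fun c s' => s'.reg rCov ≠ 0 ↔
    ∃ i < c, s.reg rV ∈ σ.rows i ∧ s.reg iW ∈ σ.rows i)
    (by rw [hj']; exact hjk.trans hc.k_le) (by decide) (by decide) (by decide)
    (fun _ _ _ h => h) (by simp [Expr.eval]) ?_ ?_
  · intro c s₁ hcx hi hf hI
    have hn : s₁.reg rN = n := (hf.reg _ (by decide)).trans (by simpa using hc.reg_n)
    have h₁ : s₁.reg rV = s.reg rV := (hf.reg _ (by decide)).trans (by simp)
    have h₂ : s₁.reg iW = s.reg iW := (hf.reg _ (by decide)).trans (by simp)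
    have h₃ : s₁.mem bRows = s.mem bRows := (hf.mem _ (by decide)).trans (by simp)
    rw [hj'] at hcx
    have h₄ := hrows c hcx _ hV
    have h₅ := hrows c hcx _ hW
    rw [zero_add] at h₄ h₅
    have key : (Expr.op .mul (.cell bRows iC rN rV) (.cell bRows iC rN iW)).eval s₁ ≠ 0 ↔
        s.reg rV ∈ σ.rows c ∧ s.reg iW ∈ σ.rows c := by
      rw [← h₄, ← h₅]
      simp [Expr.eval, Op.eval, hn, h₁, h₂, h₃, hi]
    refine .cond (fun he => .assign ?_) (fun he => .skip ?_)
    · simpa [Expr.eval] using ⟨c, by omega, key.1 he⟩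
    · rw [hI]
      constructor
      · rintro ⟨i, hic, h⟩
        exact ⟨i, by omega, h⟩
      · rintro ⟨i, hic, h⟩
        rcases Nat.lt_succ_iff_lt_or_eq.1 hic with hlt | rfl
        · exact ⟨i, hlt, h⟩
        · exact absurd he (key.2 h)
  · intro s' _ hI
    rw [hj'] at hI
    exact hI

theorem ensures_scan (hc : Setup H n k N s) (hj : s.reg rJ = σ.j) (hjk : σ.j ≤ k)
    (hrows : IsRows (s.mem bRows) 0 n σ.j σ.rows) {R : Finset ℕ} (hR : IsSet (s.mem bP) 0 n R)
    (hRn : ∀ x ∈ R, x < n) (hV : s.reg rV ∈ R) (hfound : s.reg rFound = 0) :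
    Ensures N scan s fun s' =>
      (s'.reg rFound = 0 ∧ ∀ w ∈ R, H.Adj (s.reg rV) w → σ.Covers (s.reg rV) w) ∨
      (s'.reg rFound ≠ 0 ∧ s'.reg rU ∈ R ∧ H.Adj (s.reg rV) (s'.reg rU) ∧
        ¬ σ.Covers (s.reg rV) (s'.reg rU)) := by
  refine Ensures.forLoop (fun y s' =>
      (s'.reg rFound = 0 ∧ ∀ w ∈ R, w < y → H.Adj (s.reg rV) w → σ.Covers (s.reg rV) w) ∨
      (s'.reg rFound ≠ 0 ∧ s'.reg rU ∈ R ∧ H.Adj (s.reg rV) (s'.reg rU) ∧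
        ¬ σ.Covers (s.reg rV) (s'.reg rU))) (by rw [hc.reg_n]; exact hc.n_le) (by decide)
    (by decide) (by decide) (fun _ _ _ h => h) (.inl ⟨hfound, by simp⟩) ?_ ?_
  · intro y s₁ hy hi hf hI
    rw [hc.reg_n] at hy
    have hc₁ := hc.frame hf
    have hV₁ : s₁.reg rV = s.reg rV := hf.reg _ (by decide)
    have hR₁ : IsSet (s₁.mem bP) 0 n R := by rwa [hf.mem _ (by decide)]
    have hrows₁ : IsRows (s₁.mem bRows) 0 n σ.j σ.rows := by rwa [hf.mem _ (by decide)]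
    have hj₁ : s₁.reg rJ = σ.j := (hf.reg _ (by decide)).trans hj
    have h₁ := hR₁.eval_ne (i := iW) (by omega)
    have h₂ := hc₁.eval_adj (i := rV) (j := iW) (by rw [hV₁]; exact hRn _ hV) (by omega)
    have key : (Expr.op .mul (.mem bP (.reg iW)) (.adj rV iW)).eval s₁ ≠ 0 ↔
        y ∈ R ∧ H.Adj (s.reg rV) y := by
      rw [Expr.eval, ne_eq, Op.eval_mul_eq_zero, not_or, ← ne_eq, h₁, h₂, hV₁, hi]
      simp
    -- an uncovered edge that has been found before remains valid if nothing happens at `y`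
    have hstep : (y ∈ R → H.Adj (s.reg rV) y → σ.Covers (s.reg rV) y) →
        (s₁.reg rFound = 0 ∧ ∀ w ∈ R, w < y + 1 → H.Adj (s.reg rV) w → σ.Covers (s.reg rV) w) ∨
        (s₁.reg rFound ≠ 0 ∧ s₁.reg rU ∈ R ∧ H.Adj (s.reg rV) (s₁.reg rU) ∧
          ¬ σ.Covers (s.reg rV) (s₁.reg rU)) := by
      intro hcov
      rcases hI with ⟨h₃, h₄⟩ | h₃
      · refine .inl ⟨h₃, fun w hw hwy ha => ?_⟩
        rcases Nat.lt_succ_iff_lt_or_eq.1 hwy with hlt | rfl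
        · exact h₄ w hw hlt ha
        · exact hcov hw ha
      · exact .inr h₃
    refine .cond (fun he => ?_) (fun he => .skip (hstep fun h h' => absurd he (key.2 ⟨h, h'⟩)))
    refine .seq ((ensures_covered hc₁ hj₁ hjk hrows₁ (by rw [hV₁]; exact hRn _ hV)
      (by omega)).mono fun s₂ hf₂ hcov => ?_)
    rw [hV₁, hi] at hcov
    have h₅ : s₂.reg rFound = s₁.reg rFound := hf₂.reg _ (by decide)
    have h₆ : s₂.reg rU = s₁.reg rU := hf₂.reg _ (by decide)
    have h₇ : s₂.reg iW = y := (hf₂.reg _ (by decide)).trans hi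
    refine .cond (fun hcv => .skip ?_) (fun hcv => .seq (.assign (.assign ?_)))
    · rw [h₅, h₆]
      exact hstep fun _ _ => hcov.1 hcv
    · right
      simpa [Expr.eval, h₇] using ⟨(key.1 he).1, (key.1 he).2, fun h => hcov.2 h hcv⟩
  · intro s' _ hI
    rw [hc.reg_n] at hI
    rcases hI with ⟨h₁, h₂⟩ | h₁
    · exact .inl ⟨h₁, fun w hw => h₂ w hw (hRn w hw)⟩
    · exact .inr h₁

/-- `R` is what is left of the graph in the search for an uncovered edge: the edges that leave `R`
are covered. -/
def Remaining (H : SimpleGraph ℕ) (n : ℕ) (σ : Node) (R : Finset ℕ) : Prop :=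
  (∀ x ∈ R, x < n) ∧ ∀ x y, H.Adj x y → x ∉ R → σ.Covers x y

open Classical in
theorem ensures_peel (hc : Setup H n k N s) (hj : s.reg rJ = σ.j) (hjk : σ.j ≤ k)
    (hrows : IsRows (s.mem bRows) 0 n σ.j σ.rows) (hH : ∀ x y, H.Adj x y → x < n)
    (hd : ∀ R : Finset ℕ, R.Nonempty → (∀ x ∈ R, x < n) →
      ∃ v ∈ R, (R.filter (H.Adj v)).card ≤ d) :
    Ensures N peel s fun s' =>
      (s'.reg rFound = 0 ∧ ∀ x y, H.Adj x y → σ.Covers x y) ∨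
      (s'.reg rFound ≠ 0 ∧ ∃ R, IsSet (s'.mem bP) 0 n R ∧ Remaining H n σ R ∧
        s'.reg rV ∈ R ∧ (R.filter (H.Adj (s'.reg rV))).card ≤ d ∧ s'.reg rU ∈ R ∧
        H.Adj (s'.reg rV) (s'.reg rU) ∧ ¬ σ.Covers (s'.reg rV) (s'.reg rU)) := by
  refine .seq (.fill 0 (fun _ => 1) (by rw [hc.reg_n]; exact hc.n_le) (by decide)
    (fun x s' hx hi hr hm _ => ?_) fun s₀ hr₀ hm₀ hv₀ _ => ?_)
  · simp [Expr.eval, hi]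
  refine .seq (.assign (.seq (.assign ?_)))
  generalize ht : State.setReg _ rBit _ = t
  have tr : ∀ r, r ≠ rFound → r ≠ rBit → r ≠ iY → t.reg r = s.reg r := fun r h₁ h₂ h₃ => by
    subst ht; simp [h₁, h₂, hr₀ r h₃]
  have tm : ∀ b, b ≠ bP → t.mem b = s.mem b := fun b hb => by subst ht; simp [hm₀ b hb]
  have tP : IsSet (t.mem bP) 0 n (Finset.range n) := fun x hx => by
    have := hv₀ x (by rwa [hc.reg_n])
    subst ht
    simp only [State.mem_setReg, this]
    simpa using hx
  have t9 : t.reg rBit = 1 := by subst ht; simp [Expr.eval]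
  have t13 : t.reg rFound = 0 := by subst ht; simp [Expr.eval]
  have hct : Setup H n k N t := hc.congr (fun r hr => tr r (by omega) (by omega) (by omega))
    (tm 0 (by decide))
  have hjt : t.reg rJ = σ.j := (tr 6 (by decide) (by decide) (by decide)).trans hj
  have hrt : IsRows (t.mem bRows) 0 n σ.j σ.rows := by rwa [tm 1 (by decide)]
  refine Ensures.forLoop (fun i s' =>
      (s'.reg rFound = 0 ∧ ∃ R, IsSet (s'.mem bP) 0 n R ∧ Remaining H n σ R ∧ R.card + i = n) ∨
      (s'.reg rFound ≠ 0 ∧ ∃ R, IsSet (s'.mem bP) 0 n R ∧ Remaining H n σ R ∧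
        s'.reg rV ∈ R ∧ (R.filter (H.Adj (s'.reg rV))).card ≤ d ∧ s'.reg rU ∈ R ∧
        H.Adj (s'.reg rV) (s'.reg rU) ∧ ¬ σ.Covers (s'.reg rV) (s'.reg rU)))
    (by rw [hct.reg_n]; exact hc.n_le) (by decide) (by decide) (by decide) (fun _ _ _ h => h)
    (.inl ⟨t13, Finset.range n, tP, ⟨by simp, fun x y hxy hx => ?_⟩, by simp⟩) ?_ ?_
  · exact absurd (Finset.mem_range.2 (hH x y hxy)) hx
  · intro i s₁ hi _ hf hI
    rw [hct.reg_n] at hi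
    have hc₁ := hct.frame hf
    rcases hI with ⟨hf0, R, hR, hRem, hcard⟩ | hI
    swap
    · refine .cond (fun _ => .skip (.inr hI)) (fun he => absurd he hI.1)
    refine .cond (fun he => absurd hf0 he) (fun _ => ?_)
    have hbit : s₁.reg rBit = 1 := (hf.reg _ (by decide)).trans t9
    have hRne : R.Nonempty := Finset.card_pos.1 (by omega)
    refine .seq ((ensures_minSelect hc₁ hR hRem.1 H.Adj fun v hv x hx => ?_).mono
      fun s₂ hf₂ hmin => ?_)
    · rw [hc₁.adj v hv x hx, hbit]; simp
    rcases hmin with ⟨h₁, -⟩ | ⟨-, hvR, hvm, hvmin⟩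
    · exact absurd h₁ hRne.ne_empty
    have hvd : (R.filter (H.Adj (s₂.reg rV))).card ≤ d := by
      obtain ⟨v, hv, hvd⟩ := hd R hRne hRem.1
      have := hvmin v hv
      omega
    have hc₂ := hc₁.frame hf₂
    have hR₂ : IsSet (s₂.mem bP) 0 n R := by rwa [hf₂.mem _ (by decide)]
    have hj₂ : s₂.reg rJ = σ.j := by
      rw [hf₂.reg _ (by decide), hf.reg _ (by decide), hjt]
    have hrows₂ : IsRows (s₂.mem bRows) 0 n σ.j σ.rows := by
      rwa [hf₂.mem _ (by decide), hf.mem _ (by decide)]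
    refine .seq ((ensures_scan hc₂ hj₂ hjk hrows₂ hR₂ hRem.1 hvR
      (by rw [hf₂.reg _ (by decide), hf0])).mono fun s₃ hf₃ hscan => ?_)
    have hV₃ : s₃.reg rV = s₂.reg rV := hf₃.reg _ (by decide)
    have hP₃ : s₃.mem bP = s₂.mem bP := hf₃.mem _ (by decide)
    rw [← hV₃] at hscan hvR hvd
    rw [← hP₃] at hR₂
    rcases hscan with ⟨h₁, h₂⟩ | ⟨h₁, h₂⟩
    · refine .cond (fun he => absurd h₁ he) (fun _ => .store (.inl ⟨h₁, R.erase (s₃.reg rV), ?_,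
        ⟨fun x hx => hRem.1 x (Finset.mem_of_mem_erase hx), fun x y hxy hx => ?_⟩, ?_⟩))
      · intro x hx
        have := hR₂ x hx
        rw [zero_add] at this ⊢
        simp only [State.mem_setMem, if_true, Expr.eval, Function.update_apply, Finset.mem_erase]
        rw [← this]
        by_cases hxv : x = s₃.reg rV <;> simp [hxv]
      · by_cases hxR : x ∈ R
        · obtain rfl : x = s₃.reg rV := by
            by_contra hne
            exact hx (Finset.mem_erase.2 ⟨hne, hxR⟩)
          by_cases hyR : y ∈ R
          · exact h₂ y hyR hxy
          · obtain ⟨c, hc, h, h'⟩ := hRem.2 y _ hxy.symm hyR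
            exact ⟨c, hc, h', h⟩
        · exact hRem.2 x y hxy hxR
      · rw [Finset.card_erase_of_mem hvR]; omega
    · exact .cond (fun _ => .skip (.inr ⟨h₁, R, hR₂, hRem, hvR, hvd, h₂⟩)) (fun he => absurd he h₁)
  · intro s' _ hI
    rw [hct.reg_n] at hI
    rcases hI with ⟨h₁, R, -, hRem, hcard⟩ | hI
    · refine .inl ⟨h₁, fun x y hxy => hRem.2 x y hxy ?_⟩
      rw [Finset.card_eq_zero.1 (by omega : R.card = 0)]
      simp
    · exact .inr hI

/-- If fewer than `k` cliques have been started, the child is put on the stack; otherwise the node does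
not extend to a cover, and is dropped. -/
theorem ensures_startClique (hc : Setup H n k N s) (hσ : σ.Valid H n k) (hj : s.reg rJ = σ.j)
    (hrows : IsRows (s.mem bRows) 0 n σ.j σ.rows) (hP : σ.P = ∅) {R : Finset ℕ}
    (hR : IsSet (s.mem bP) 0 n R) (hRem : Remaining H n σ R) (hV : s.reg rV ∈ R)
    (hVd : ((σ.new H R (s.reg rV)).P).card ≤ d) (hU : s.reg rU ∈ R)
    (hVU : H.Adj (s.reg rV) (s.reg rU)) (hcov : ¬ σ.Covers (s.reg rV) (s.reg rU))
    {E : Prop} {W : ℝ} (h : StackInv H n k d s.mem (s.reg rSp) E W) :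
    Ensures N startClique s fun s' => StackInv H n k d s'.mem (s'.reg rSp)
      (E ∨ σ.Extends H k) (W + σ.weight n k d - 1) := by
  classical
  set v := s.reg rV with hv
  have hvn : v < n := hRem.1 v hV
  have hext : σ.Extends H k → σ.j < k ∧ ((σ.new H R v).add H (s.reg rU)).Extends H k :=
    fun hE => hE.new_add hP hRem.2 hV hU hVU hcov
  refine .cond (fun he => ?_) (fun he => .skip (h.mono ?_ ?_))
  · have hjk : σ.j < k := by
      simpa only [Expr.eval, ne_eq, Op.eval_lt_eq_zero, not_le, hj, hc.reg_k] using he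
    have hτ := hσ.new hjk hRem.1 v
    have hwt := Node.weight_new_add_le (σ := σ) (H := H) (n := n) (v := v) (s.reg rU) hjk hRem.1 hVd
    refine .seq (.fill (σ.j * n) (fun x => if x = v then 1 else 0)
      (by rw [hc.reg_n]; exact hc.n_le) (by decide) (fun x s' hx hi hr hm _ => ?_)
      fun s₁ hr₁ hm₁ hv₁ ho₁ => ?_)
    · simp [Expr.eval, Op.eval, hi, hr, hj, hc.reg_n, hv]
    have hc₁ : Setup H n k N s₁ := hc.congr (fun r hr => hr₁ r (by omega)) (hm₁ 0 (by decide))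
    refine .seq (.fill 0 (fun x => if 0 < s.mem bP x * s.mem bAdj (v * n + x) then 1 else 0)
      (by rw [hc₁.reg_n]; exact hc.n_le) (by decide) (fun x s' hx hi hr hm ho => ?_)
      fun s₂ hr₂ hm₂ hv₂ ho₂ => ?_)
    · rw [zero_add] at ho
      simp [Expr.eval, Op.eval, hi, hr, hm, ho, hr₁, hm₁, hc.reg_n, ← hv]
    have hc₂ : Setup H n k N s₂ := hc₁.congr (fun r hr => hr₂ r (by omega)) (hm₂ 0 (by decide))
    refine .seq (.assign ?_)
    generalize ht : State.setReg _ rJ _ = t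
    have tm : t.mem = s₂.mem := by subst ht; rfl
    have tr : ∀ r, r ≠ rJ → t.reg r = s₂.reg r := fun r hr' => by subst ht; simp [hr']
    have hct : Setup H n k N t := hc₂.congr (fun r hr => tr r (by omega)) (by rw [tm])
    have t5 : t.reg rSp = s.reg rSp := by
      rw [tr _ (by decide), hr₂ _ (by decide), hr₁ _ (by decide)]
    have t7 : t.reg rU = s.reg rU := by
      rw [tr _ (by decide), hr₂ _ (by decide), hr₁ _ (by decide)]
    have hadj : ∀ x < n, s.mem bAdj (v * n + x) = if H.Adj v x then 1 else 0 := hc.adj v hvn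
    have hw : Working n t (σ.new H R v) := by
      refine ⟨?_, fun c hcj x hx => ?_, fun x hx => ?_⟩
      · subst ht; simp [Expr.eval, Op.eval, hr₂, hr₁, hj, Node.new]
      · rw [tm, hm₂ 1 (by decide), zero_add]
        by_cases hcj' : c = σ.j
        · subst hcj'
          rw [hv₁ x (by rwa [hc.reg_n])]
          simp [Node.new]
        · have hlt : c < σ.j := by simp only [Node.new] at hcj; omega
          rw [ho₁ _ fun y hy e => ?_]
          · simpa [Node.new, hcj'] using hrows c hlt x hx
          · rw [hc.reg_n] at hy
            exact hcj' ((mul_add_eq_iff hx hy).1 e).1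
      · rw [tm, hv₂ x (by rwa [hc₁.reg_n]), hadj x hx]
        have := hR x hx
        rw [zero_add] at this
        simp only [Node.new, Finset.mem_filter]
        rw [← this]
        by_cases hux : H.Adj v x <;> simp [hux, Nat.pos_iff_ne_zero]
    have hst : StackInv H n k d t.mem (t.reg rSp) E W := by
      obtain ⟨φ, υ, h₁, h₂, h₃⟩ := h
      rw [t5, tm]
      refine ⟨φ, υ, fun f hf => ⟨?_, (h₁ f hf).2⟩, h₂, h₃⟩
      have hmem : ∀ b, b ≠ 1 → b ≠ 6 → s₂.mem b = s.mem b := fun b h₁ h₆ => by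
        rw [hm₂ b h₆, hm₁ b h₁]
      obtain ⟨a, b, c, e⟩ := (h₁ f hf).1
      exact ⟨by rwa [hmem _ (by decide) (by decide)], by rwa [hmem _ (by decide) (by decide)],
        by rwa [hmem _ (by decide) (by decide)], by rwa [hmem _ (by decide) (by decide)]⟩
    have hUP : t.reg rU ∈ (σ.new H R v).P := by
      rw [t7]
      exact Finset.mem_filter.2 ⟨hU, hVU⟩
    refine (ensures_push hct hw (by rw [t7]; exact hRem.1 _ hU) (hτ.add hUP) hst).mono
      fun s' _ h' => ?_
    rw [t7] at h'
    refine h'.mono ?_ (by linarith)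
    rintro (hE | hE)
    · exact .inl hE
    · exact .inr (hext hE).2
  · rintro (hE | hE)
    · exact hE
    · have : k ≤ σ.j := by
        simpa only [Expr.eval, Op.eval_lt_eq_zero, hj, hc.reg_k] using he
      exact absurd (hext hE).1 (by omega)
  · have := σ.one_le_weight n k d
    linarith

/-! ### Traversing the search tree -/

/-- The state of the search: either it is still going on, or it has been successful. The
number `M` bounds the number of iterations that are left; it has no meaning after a success. -/
def SearchInv (H : SimpleGraph ℕ) (n k N d : ℕ) (E : Prop) (M : ℕ) (s : State) : Prop :=
  Setup H n k N s ∧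
    ((s.reg rRes = 0 ∧ StackInv H n k d s.mem (s.reg rSp) E M) ∨
      (s.reg rRes ≠ 0 ∧ s.reg rSp = 0 ∧ ∃ σ : Node, σ.Valid H n k ∧ s.reg rJ = σ.j ∧
        IsRows (s.mem bRows) 0 n σ.j σ.rows ∧ ∀ x y, H.Adj x y → σ.Covers x y))

open Classical in
/-- Processing a node replaces it by its children. Their total weight is smaller by at least `1`, and
one of them extends to a cover if the node does. -/
theorem ensures_processNode (hH : ∀ x y, H.Adj x y → x < n)
    (hd : ∀ R : Finset ℕ, R.Nonempty → (∀ x ∈ R, x < n) →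
      ∃ v ∈ R, (R.filter (H.Adj v)).card ≤ d)
    {E : Prop} {M : ℕ} (h : SearchInv H n k N d E M s) (hsp : s.reg rSp ≠ 0) :
    ∃ M', M = M' + 1 ∧ Ensures N processNode s (SearchInv H n k N d E M') := by
  classical
  obtain ⟨hc, ⟨hres, hst⟩ | ⟨-, h0, -⟩⟩ := h
  swap
  · exact absurd h0 hsp
  have hM : 1 ≤ M := by
    obtain ⟨sp, hsp'⟩ := Nat.exists_eq_succ_of_ne_zero hsp
    obtain ⟨φ, υ, -, -, h₃⟩ := hst
    rw [hsp', Finset.sum_range_succ] at h₃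
    have h₁ := ((φ sp).add H (υ sp)).one_le_weight n k d
    have h₂ : 0 ≤ ∑ f ∈ Finset.range sp, ((φ f).add H (υ f)).weight n k d :=
      Finset.sum_nonneg fun f _ => zero_le_one.trans (Node.one_le_weight _ _ _ _)
    have : (1 : ℝ) ≤ M := by linarith
    exact_mod_cast this
  obtain ⟨M', rfl⟩ : ∃ M', M = M' + 1 := ⟨M - 1, by omega⟩
  refine ⟨M', rfl, ?_⟩
  refine .seq ((ensures_pop hc hsp hst).mono ?_)
  rintro s₁ hf₁ ⟨σ, hw, hσ, hst₁⟩
  have hc₁ := hc.frame hf₁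
  have hres₁ : s₁.reg rRes = 0 := (hf₁.reg _ (by decide)).trans hres
  refine .seq (.assign ?_)
  set t := s₁.setReg rBit ((Expr.const 0).eval s₁) with ht
  have hct : Setup H n k N t := hc₁.congr (fun r hr => by
    simp [ht, show r ≠ 9 by omega]) rfl
  have hwt : Working n t σ := hw.setReg (by decide)
  have t9 : t.reg rBit = 0 := by simp [ht, Expr.eval]
  have t8 : t.reg rRes = 0 := by simpa [ht] using hres₁
  have hstt : StackInv H n k d t.mem (t.reg rSp) (E ∧ ¬ σ.Extends H k)
      ((M' + 1 : ℕ) - σ.weight n k d) := hst₁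
  refine .seq ((ensures_minSelect hct hwt.P hσ.lt (fun v x => ¬ H.Adj v x)
    fun v hv x hx => ?_).mono fun s₂ hf₂ hmin => ?_)
  · rw [hct.adj v hv x hx, t9]; simp
  have hc₂ := hct.frame hf₂
  have hw₂ := hwt.frame hf₂
  have hst₂ : StackInv H n k d s₂.mem (s₂.reg rSp) (E ∧ ¬ σ.Extends H k)
      ((M' + 1 : ℕ) - σ.weight n k d) := by
    rw [hf₂.reg _ (by decide)]
    exact hstt.frame hf₂
  have hres₂ : s₂.reg rRes = 0 := (hf₂.reg _ (by decide)).trans t8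
  have hE : E → (E ∧ ¬ σ.Extends H k) ∨ σ.Extends H k := by tauto
  have hWt : ((M' + 1 : ℕ) : ℝ) - σ.weight n k d + σ.weight n k d - 1 ≤ M' := by
    push_cast; linarith
  refine .cond (fun he => ?_) (fun he => ?_)
  · have hlt : n < s₂.reg rMin := by
      simpa only [Expr.eval, ne_eq, Op.eval_lt_eq_zero, not_le, hc₂.reg_n] using he
    have hP : σ.P = ∅ := by
      rcases hmin with ⟨h, -⟩ | ⟨h, -⟩
      · exact h
      · omega
    refine .seq ((ensures_peel hc₂ hw₂.j hσ.le hw₂.rows hH hd).mono fun s₃ hf₃ hpeel => ?_)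
    have hc₃ := hc₂.frame hf₃
    have hres₃ : s₃.reg rRes = 0 := (hf₃.reg _ (by decide)).trans hres₂
    have hj₃ : s₃.reg rJ = σ.j := (hf₃.reg _ (by decide)).trans hw₂.j
    have hrows₃ : IsRows (s₃.mem bRows) 0 n σ.j σ.rows := by
      rw [hf₃.mem _ (by decide)]; exact hw₂.rows
    have hst₃ : StackInv H n k d s₃.mem (s₃.reg rSp) (E ∧ ¬ σ.Extends H k)
        ((M' + 1 : ℕ) - σ.weight n k d) := by
      rw [hf₃.reg _ (by decide)]
      exact hst₂.frame hf₃
    rcases hpeel with ⟨h₁, h₂⟩ | ⟨h₁, R, hR, hRem, hV, hVd, hU, hVU, hcov⟩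
    · refine .cond (fun he => absurd h₁ he) (fun _ => .seq (.assign (.assign ⟨?_, .inr ?_⟩)))
      · exact hc₃.congr (fun r hr => by
          simp [show r ≠ 8 by omega, show r ≠ 5 by omega]) rfl
      · refine ⟨by simp [Expr.eval], by simp [Expr.eval], σ, hσ, by simpa using hj₃, hrows₃, h₂⟩
    · refine .cond (fun _ => ?_) (fun he => absurd he h₁)
      refine (ensures_startClique hc₃ hσ hj₃ hrows₃ hP hR hRem hV hVd hU hVU hcov hst₃).mono
        fun s₄ hf₄ h₄ => ⟨hc₃.frame hf₄, .inl ⟨(hf₄.reg _ (by decide)).trans hres₃, h₄.mono hE hWt⟩⟩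
  · have hle : s₂.reg rMin ≤ n := by
      simpa only [Expr.eval, Op.eval_lt_eq_zero, hc₂.reg_n] using he
    rcases hmin with ⟨-, h⟩ | ⟨-, hV, hm, hmin⟩
    · omega
    refine (ensures_branch hc₂ hw₂ hσ hV 
      (fun u hu => ?_) hst₂).mono
      fun s₃ hf₃ h₃ => ⟨hc₂.frame hf₃, .inl ⟨(hf₃.reg _ (by decide)).trans hres₂, h₃.mono hE hWt⟩⟩
    refine (le_of_eq ?_).trans ((hm.symm.le.trans (hmin u hu)).trans (le_of_eq ?_)) <;> congr

/-- `H` has an edge clique cover that consists of `k` (possibly empty) cliques. -/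
def HasCover (H : SimpleGraph ℕ) (k : ℕ) : Prop :=
  ∃ f : ℕ → Finset ℕ, (∀ c < k, H.IsClique (f c : Set ℕ)) ∧
    ∀ v w, H.Adj v w → ∃ c < k, v ∈ f c ∧ w ∈ f c

/-- A bound on the number of nodes that the search processes. -/
noncomputable def nodeBound (n k d : ℕ) : ℕ := ⌈(1.4423 : ℝ) ^ (k * d) * (k * (n + 1) + 1 : ℕ)⌉₊

open Classical in
theorem steps_search (hc : Setup H n k N s) (hn : 0 < n) (hH : ∀ x y, H.Adj x y → x < n)
    (hd : ∀ R : Finset ℕ, R.Nonempty → (∀ x ∈ R, x < n) →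
      ∃ v ∈ R, (R.filter (H.Adj v)).card ≤ d)
    (hmem : ∀ b a, b ≠ bAdj → s.mem b a = 0) (hres : s.reg rRes = 0) :
    ∃ s' m, Steps search s s' m ∧ m ≤ nodeBound n k d * (processNode.budget N + 1) + 5 ∧
      ((s'.reg 0 = 1 ∧ ∃ σ : Node, σ.Valid H n k ∧ s'.reg 1 = σ.j ∧
        IsRows (s'.mem 1) 0 n σ.j σ.rows ∧ ∀ x y, H.Adj x y → σ.Covers x y) ∨
        (s'.reg 0 = 0 ∧ ¬ HasCover H k)) := by
  set root : Node := ⟨0, fun _ => ∅, ∅⟩ with hroot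
  have hrootP : (root.add H 0).P = ∅ := by simp [Node.add, hroot]
  have hvalid : (root.add H 0).Valid H n k :=
    ⟨Nat.zero_le _, fun c hc => absurd hc (Nat.not_lt_zero c),
      fun c _ p hp => by simp [hrootP] at hp, fun p hp => by simp [hrootP] at hp, fun _ => hrootP⟩
  have hext : HasCover H k → (root.add H 0).Extends H k := by
    rintro ⟨f, h₁, h₂⟩
    exact ⟨f, h₁, h₂, fun c hc => absurd hc (Nat.not_lt_zero _),
      fun c hc => absurd hc (Nat.succ_ne_zero c)⟩
  have hweight : (root.add H 0).weight n k d ≤ nodeBound n k d := by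
    refine le_trans (le_of_eq ?_) (Nat.le_ceil _)
    have : (root.add H 0).j = 0 := rfl
    simp [Node.weight, Node.leaves, Node.height, hrootP, this]
  have h0 : SearchInv H n k N d (HasCover H k) (nodeBound n k d)
      (s.setReg rSp ((Expr.const 1).eval s)) := by
    refine ⟨hc.congr (fun r hr => by simp [show r ≠ 5 by omega]) rfl, .inl ⟨by simpa using hres,
      fun _ => root, fun _ => 0, fun f hf => ⟨⟨?_, ?_, fun c hc => ?_, fun x hx => ?_⟩, hn, hvalid⟩,
      fun h => ⟨0, by simp [Expr.eval], hext h⟩, by simpa [Expr.eval] using hweight⟩⟩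
    · simp [hmem, hroot]
    · simp [hmem]
    · exact absurd hc (Nat.not_lt_zero c)
    · simp [hmem, hroot]
  obtain ⟨s₁, m₁, r₁, l₁, he, M', -, hinv⟩ := Ensures.steps_loop (e := .reg rSp)
    (SearchInv H n k N d (HasCover H k))
    (fun M s' h he => ensures_processNode hH hd h he) _ h0
  have he' : s₁.reg rSp = 0 := he
  rcases hinv with ⟨h₁, h₂⟩ | ⟨h₁, -, σ, hσ, hj, hrows, hcov⟩
  · refine ⟨_, _, .seq (.assign _ _ _) (.seq r₁ (.cond_false h₁ (.assign _ _ _))), by omega,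
      .inr ⟨by simp [Expr.eval], fun hE => ?_⟩⟩
    obtain ⟨φ, υ, -, h₃, -⟩ := h₂
    obtain ⟨f, hf, -⟩ := h₃ hE
    omega
  · refine ⟨_, _, .seq (.assign _ _ _) (.seq r₁ (.cond_true h₁ (.seq (.assign _ _ _)
      (.assign _ _ _)))), by omega, .inl ⟨by simp [Expr.eval], σ, hσ, ?_, hrows, hcov⟩⟩
    simpa [Expr.eval] using hj

/-! ### The graph as a graph on the natural numbers -/

section Lift

variable (G : SimpleGraph (Fin n))

/-- The graph `G`, regarded as a graph on the natural numbers. -/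
def lift : SimpleGraph ℕ := G.map Fin.valEmbedding

variable {G}

theorem lift_adj (u v : Fin n) : (lift G).Adj u v ↔ G.Adj u v := by
  exact SimpleGraph.map_adj_apply (f := Fin.valEmbedding)

theorem exists_of_lift_adj {x y : ℕ} (h : (lift G).Adj x y) :
    ∃ u v : Fin n, G.Adj u v ∧ (u : ℕ) = x ∧ (v : ℕ) = y := by
  exact (SimpleGraph.map_adj Fin.valEmbedding G x y).1 h

theorem lt_of_lift_adj {x y : ℕ} (h : (lift G).Adj x y) : x < n := by
  obtain ⟨u, v, -, rfl, -⟩ := exists_of_lift_adj h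
  exact u.2

open Classical in
theorem input_mem (k : ℕ) {v x : ℕ} (hv : v < n) (hx : x < n) :
    (input G k).mem 0 (v * n + x) = if (lift G).Adj v x then 1 else 0 := by
  unfold input
  refine if_congr ?_ rfl rfl
  constructor
  · rintro ⟨-, i, j, h, hij⟩
    obtain ⟨rfl, rfl⟩ := (mul_add_eq_iff hx j.2).1 h
    exact (lift_adj i j).2 hij
  · intro h
    exact ⟨rfl, ⟨v, hv⟩, ⟨x, hx⟩, rfl, (lift_adj ⟨v, hv⟩ ⟨x, hx⟩).1 h⟩

theorem degeneracy_mem (G : SimpleGraph (Fin n)) (K : G.Subgraph) (hK : K.verts.Nonempty) :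
    ∃ v ∈ K.verts, (K.neighborSet v).ncard ≤ degeneracy G := by
  have hne : {d : ℕ | ∀ K : G.Subgraph, K.verts.Nonempty →
      ∃ v ∈ K.verts, (K.neighborSet v).ncard ≤ d}.Nonempty := by
    refine ⟨n, fun K ⟨v, hv⟩ => ⟨v, hv, ?_⟩⟩
    have := Set.ncard_le_card (K.neighborSet v)
    simpa using this
  exact Nat.sInf_mem hne K hK

theorem degeneracy_le (G : SimpleGraph (Fin n)) : degeneracy G ≤ n := by
  refine Nat.sInf_le fun K ⟨v, hv⟩ => ⟨v, hv, ?_⟩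
  simpa using Set.ncard_le_card (K.neighborSet v)

theorem one_le_degeneracy {u v : Fin n} (h : G.Adj u v) : 1 ≤ degeneracy G := by
  obtain ⟨w, hw, hle⟩ := degeneracy_mem G (G.subgraphOfAdj h) ⟨u, by simp⟩
  refine le_trans ?_ hle
  rw [Nat.one_le_iff_ne_zero, ← Nat.pos_iff_ne_zero, Set.ncard_pos]
  simp only [SimpleGraph.subgraphOfAdj_verts, Set.mem_insert_iff, Set.mem_singleton_iff] at hw
  rcases hw with rfl | rfl
  · exact ⟨v, by simp⟩
  · exact ⟨u, by simp⟩

open Classical in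
theorem exists_card_filter_le_degeneracy {R : Finset ℕ} (hR : R.Nonempty)
    (hRn : ∀ x ∈ R, x < n) : ∃ v ∈ R, (R.filter ((lift G).Adj v)).card ≤ degeneracy G := by
  obtain ⟨x₀, hx₀⟩ := hR
  obtain ⟨v, hv, hle⟩ := degeneracy_mem G ((⊤ : G.Subgraph).induce {v | (v : ℕ) ∈ R})
    ⟨⟨x₀, hRn x₀ hx₀⟩, by simpa using hx₀⟩
  have hvR : (v : ℕ) ∈ R := by simpa using hv
  refine ⟨v, hvR, le_trans (le_of_eq ?_) hle⟩
  rw [← Set.ncard_coe_finset, ← Set.ncard_image_of_injective _ Fin.val_injective]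
  congr 1
  ext x
  simp only [Finset.coe_filter, Set.mem_ofPred_eq, Set.mem_image, SimpleGraph.Subgraph.mem_neighborSet,
    SimpleGraph.Subgraph.induce_adj, SimpleGraph.Subgraph.top_adj]
  constructor
  · rintro ⟨hx, ha⟩
    exact ⟨⟨x, hRn x hx⟩, ⟨hvR, hx, (lift_adj v ⟨x, hRn x hx⟩).1 ha⟩, rfl⟩
  · rintro ⟨w, ⟨-, hw, ha⟩, rfl⟩
    exact ⟨hw, (lift_adj v w).2 ha⟩

theorem hasCover_of_isEdgeCliqueCover {𝒞 : Finset (Finset (Fin n))} (h : IsEdgeCliqueCover G 𝒞)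
    (hk : 𝒞.card ≤ k) : HasCover (lift G) k := by
  refine ⟨fun c => (𝒞.toList.getD c ∅).map Fin.valEmbedding, fun c _ => ?_, fun x y hxy => ?_⟩
  · have hcl : G.IsClique (𝒞.toList.getD c ∅ : Set (Fin n)) := by
      rcases Nat.lt_or_ge c 𝒞.toList.length with hlt | hge
      · rw [List.getD_eq_getElem _ _ hlt]
        exact h.1 _ (Finset.mem_toList.1 (List.getElem_mem hlt))
      · rw [List.getD_eq_default _ _ hge]
        simp
    rw [Finset.coe_map]
    exact hcl.map
  · obtain ⟨u, v, huv, rfl, rfl⟩ := exists_of_lift_adj hxy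
    obtain ⟨C, hC, hu, hv⟩ := h.2 u v huv
    obtain ⟨c, hc, hcC⟩ := List.getElem_of_mem (Finset.mem_toList.2 hC)
    refine ⟨c, by rw [Finset.length_toList] at hc; omega, ?_⟩
    dsimp only
    rw [List.getD_eq_getElem _ _ hc, hcC]
    exact ⟨Finset.mem_map_of_mem Fin.valEmbedding hu, Finset.mem_map_of_mem Fin.valEmbedding hv⟩

/-- More than `n * n` cliques are never needed: one for each edge suffices. -/
theorem HasCover.min (h : HasCover (lift G) k) : HasCover (lift G) (min k (n * n)) := by
  classical
  rcases Nat.le_total k (n * n) with hk | hk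
  · rwa [Nat.min_eq_left hk]
  · rw [Nat.min_eq_right hk]
    refine ⟨fun c => if (lift G).Adj (c / n) (c % n) then {c / n, c % n} else ∅, fun c _ => ?_,
      fun x y hxy => ⟨x * n + y, ?_, ?_⟩⟩
    · dsimp only
      split_ifs with hadj
      · simpa [SimpleGraph.isClique_pair] using fun _ => hadj
      · simp
    · exact add_mul_lt (lt_of_lift_adj hxy) le_rfl (lt_of_lift_adj hxy.symm)
    · have hy := lt_of_lift_adj hxy.symm
      have h₁ : (x * n + y) / n = x := by
        rw [mul_comm, Nat.mul_add_div (by omega), Nat.div_eq_of_lt hy, add_zero]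
      have h₂ : (x * n + y) % n = y := by
        rw [mul_comm, Nat.mul_add_mod, Nat.mod_eq_of_lt hy]
      simp [h₁, h₂, hxy]

theorem isCorrectAnswer_of_covers {k' : ℕ} (hk : k' ≤ k) (h0 : s.reg 0 = 1)
    (hσ : σ.Valid (lift G) n k') (h1 : s.reg 1 = σ.j) (hrows : IsRows (s.mem 1) 0 n σ.j σ.rows)
    (hcov : ∀ x y, (lift G).Adj x y → σ.Covers x y) : IsCorrectAnswer G k (output n s) := by
  have hmem : ∀ c < σ.j, ∀ v : Fin n, s.mem 1 (c * n + v) ≠ 0 ↔ (v : ℕ) ∈ σ.rows c := by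
    intro c hc v
    simpa using hrows c hc v v.2
  rw [output, if_neg (by omega), h1]
  refine ⟨⟨fun C hC => ?_, fun u v huv => ?_⟩, Finset.card_image_le.trans ?_⟩
  · obtain ⟨c, hc, rfl⟩ := Finset.mem_image.1 hC
    rw [Finset.mem_range] at hc
    intro u hu v hv huv
    simp only [Finset.coe_filter, Finset.mem_univ, true_and, Set.mem_ofPred_eq, hmem c hc] at hu hv
    exact (lift_adj u v).1 (hσ.clique c hc hu hv fun h => huv (Fin.ext h))
  · obtain ⟨c, hc, hu, hv⟩ := hcov u v ((lift_adj u v).2 huv)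
    refine ⟨_, Finset.mem_image_of_mem _ (Finset.mem_range.2 hc), ?_⟩
    simp only [Finset.mem_filter, Finset.mem_univ, true_and, hmem c hc]
    exact ⟨hu, hv⟩
  · rw [Finset.card_range]
    exact hσ.le.trans hk

end Lift

/-! ### The complete program and its running time -/

/-- Test whether the graph has an edge. -/
def findEdge : Prog :=
  .seq (.assign rFound (.const 0))
    (.forLoop iV rN (.forLoop iX rN (.cond (.adj iV iX) (.assign rFound (.const 1)) .skip)))

/-- Replace `k` by `min k (n * n)` and compute the size `k * n` of the matrix of cliques. -/
def prepare : Prog :=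
  .seq (.cond (.op .lt (.op .mul (.reg rN) (.reg rN)) (.reg rK))
      (.assign rK (.op .mul (.reg rN) (.reg rN))) .skip)
    (.assign rKN (.op .mul (.reg rK) (.reg rN)))

/-- The program for Edge Clique Cover. If there is no edge, so that the degeneracy is `0`, it does
not look at `k`, because not even reading `k` fits into the time bound then. -/
def edgeCliqueCover : Prog :=
  .seq findEdge (.cond (.reg rFound) (.seq prepare search)
    (.seq (.assign rN (.const 1)) (.assign rK (.const 0))))

theorem ensures_findEdge {G : SimpleGraph (Fin n)} :
    Ensures n findEdge (input G k) fun s' => s'.reg rFound ≤ 1 ∧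
      (s'.reg rFound ≠ 0 ↔ ∃ x y, (lift G).Adj x y) := by
  classical
  set s := input G k with hs
  have hn : s.reg rN = n := by simp [hs, input]
  refine .seq (.assign ?_)
  set t := s.setReg rFound ((Expr.const 0).eval s) with ht
  have tn : t.reg rN = n := by simp [ht, hn]
  refine Ensures.forLoop (fun v s' => s'.reg rFound ≤ 1 ∧
      (s'.reg rFound ≠ 0 ↔ ∃ x y, x < v ∧ (lift G).Adj x y)) (by omega) (by decide) (by decide)
    (by decide) (fun _ _ _ h => h) (by simp [ht, Expr.eval]) ?_ ?_
  · intro v s₁ hv hi hf ⟨hle, hI⟩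
    rw [tn] at hv
    have hn₁ : s₁.reg rN = n := (hf.reg _ (by decide)).trans tn
    refine Ensures.forLoop (fun y s' => s'.reg rFound ≤ 1 ∧ (s'.reg rFound ≠ 0 ↔
        (∃ x z, x < v ∧ (lift G).Adj x z) ∨ ∃ z < y, (lift G).Adj v z)) (by omega) (by decide)
      (by decide) (by decide) (fun _ _ _ h => h) ⟨hle, by simpa using hI⟩ ?_ ?_
    · intro y s₂ hy hi₂ hf₂ ⟨hle₂, hI₂⟩
      rw [hn₁] at hy
      have h₁ : s₂.reg iV = v := (hf₂.reg _ (by decide)).trans hi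
      have h₂ : s₂.reg rN = n := (hf₂.reg _ (by decide)).trans hn₁
      have h₃ : s₂.mem bAdj = s.mem bAdj := (hf₂.mem _ (by decide)).trans (hf.mem _ (by decide))
      have he : (Expr.adj iV iX).eval s₂ = if (lift G).Adj v y then 1 else 0 := by
        simp only [Expr.eval, Op.eval, h₁, h₂, h₃, hi₂]
        exact input_mem k hv hy
      refine .cond (fun h => .assign ?_) (fun h => .skip ⟨hle₂, hI₂.trans (or_congr_right ?_)⟩)
      · have hadj : (lift G).Adj v y := by
          by_contra hne
          rw [he, if_neg hne] at h
          exact h rfl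
        refine ⟨by simp [Expr.eval], ?_⟩
        simpa [Expr.eval] using Or.inr ⟨y, by omega, hadj⟩
      · constructor
        · rintro ⟨z, hz, h⟩
          exact ⟨z, by omega, h⟩
        · rintro ⟨z, hz, hadj⟩
          rcases Nat.lt_succ_iff_lt_or_eq.1 hz with hlt | rfl
          · exact ⟨z, hlt, hadj⟩
          · rw [he, if_pos hadj] at h
            exact absurd h one_ne_zero
    · rintro s₂ _ ⟨hle₂, hI₂⟩
      rw [hn₁] at hI₂
      refine ⟨hle₂, hI₂.trans ⟨?_, ?_⟩⟩
      · rintro (⟨x, z, hx, h⟩ | ⟨z, -, h⟩)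
        · exact ⟨x, z, by omega, h⟩
        · exact ⟨v, z, by omega, h⟩
      · rintro ⟨x, z, hx, h⟩
        rcases Nat.lt_succ_iff_lt_or_eq.1 hx with hlt | rfl
        · exact .inl ⟨x, z, hlt, h⟩
        · exact .inr ⟨z, lt_of_lift_adj h.symm, h⟩
  · rintro s' _ ⟨hle, hI⟩
    rw [tn] at hI
    refine ⟨hle, hI.trans ⟨?_, ?_⟩⟩
    · rintro ⟨x, y, -, h⟩
      exact ⟨x, y, h⟩
    · rintro ⟨x, y, h⟩
      exact ⟨x, y, lt_of_lift_adj h, h⟩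

theorem run_prepare {B : ℕ} (hB : 1 ≤ B) (hs : s.BoundedBy (fun i => i ≠ rK) B)
    (hn : s.reg rN = n) (hk : s.reg rK = k) :
    ∃ s' t, Run prepare s s' t ∧ t ≤ 30 * (B + k + 1) ∧ s'.reg rK = min k (n * n) ∧
      s'.reg rKN = min k (n * n) * n ∧ (∀ r, r ≠ rK → r ≠ rKN → s'.reg r = s.reg r) ∧
      s'.mem = s.mem := by
  have hbd : ∀ {s : State}, s.BoundedBy (fun i => i ≠ rK) B → s.reg rK ≤ k →
      s.BoundedBy (fun _ => true) (B + k) := by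
    intro s h h'
    refine ⟨fun i _ => ?_, fun b a => (h.2 b a).trans (by omega)⟩
    by_cases hi : i = rK
    · subst hi; omega
    · exact (h.1 i (by simpa using hi)).trans (by omega)
  have h₁ := hbd hs hk.le
  have hL : B + k < 2 ^ (B + k) := Nat.lt_two_pow_self
  have hB' : 1 ≤ B + k := by omega
  set e₁ : Expr := .op .mul (.reg rN) (.reg rN) with he₁
  set e₂ : Expr := .op .lt e₁ (.reg rK) with he₂
  set e₃ : Expr := .op .mul (.reg rK) (.reg rN) with he₃
  have c₁ := Expr.cost_le h₁ hB' hL e₁ rfl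
  have l₁ := Expr.len_eval_le h₁ hB' hL e₁ rfl
  have c₂ := Expr.cost_le h₁ hB' hL e₂ rfl
  have l₂ := Expr.len_eval_le h₁ hB' hL e₂ rfl
  -- the state after the first instruction
  obtain ⟨s₁, t₁, r₁, hle, hk₁, hr₁, hm₁⟩ : ∃ s₁ t₁, Run (.cond e₂ (.assign rK e₁) .skip) s s₁ t₁ ∧
      t₁ ≤ 18 * (B + k + 1) ∧ s₁.reg rK = min k (n * n) ∧ (∀ r, r ≠ rK → s₁.reg r = s.reg r) ∧
      s₁.mem = s.mem := by
    have hcharge : e₁.charge = 4 ∧ e₁.width = 2 ∧ e₂.charge = 8 ∧ e₂.width = 3 := ⟨rfl, rfl, rfl, rfl⟩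
    obtain ⟨q₁, q₂, q₃, q₄⟩ := hcharge
    rw [q₁] at c₁; rw [q₂] at l₁; rw [q₃] at c₂; rw [q₄] at l₂
    have heval : e₂.eval s = if n * n < k then 1 else 0 := by
      simp [he₂, he₁, Expr.eval, Op.eval, hn, hk]
    by_cases hlt : n * n < k
    · refine ⟨_, _, .cond_true (by simp [heval, hlt]) (.assign _ _ _), by omega, ?_, ?_, rfl⟩
      · simp [he₁, Expr.eval, Op.eval, hn, hlt.le]
      · intro r hr; simp [hr]
    · refine ⟨_, _, .cond_false (by simp [heval, hlt]) (.skip _), by omega, ?_, fun _ _ => rfl, rfl⟩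
      simp [hk, not_lt.1 hlt]
  have h₂ : s₁.BoundedBy (fun _ => true) (B + k) := by
    refine hbd ⟨fun i hi => ?_, fun b a => by rw [hm₁]; exact hs.2 b a⟩ (by omega)
    rw [hr₁ i (by simpa using hi)]
    exact hs.1 i hi
  have c₃ := Expr.cost_le h₂ hB' hL e₃ rfl
  have l₃ := Expr.len_eval_le h₂ hB' hL e₃ rfl
  rw [show e₃.charge = 4 from rfl] at c₃
  rw [show e₃.width = 2 from rfl] at l₃
  refine ⟨_, _, .seq r₁ (.assign rKN e₃ s₁), by omega, by simpa using hk₁, ?_, fun r h h' => ?_, hm₁⟩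
  · simp [he₃, Expr.eval, Op.eval, hk₁, hr₁, hn]
  · simp [h', hr₁ r h]

/-- `f` is bounded by a polynomial. -/
def PolyBounded (f : ℕ → ℕ) : Prop := ∃ A c : ℕ, ∀ n, f n ≤ A * (n + 1) ^ c

namespace PolyBounded

variable {f g : ℕ → ℕ}

theorem const (a : ℕ) : PolyBounded fun _ => a := ⟨a, 0, fun n => by simp⟩

theorem id : PolyBounded fun n => n := ⟨1, 1, fun n => by simp⟩

theorem add (hf : PolyBounded f) (hg : PolyBounded g) : PolyBounded fun n => f n + g n := by
  obtain ⟨A, c, h⟩ := hf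
  obtain ⟨A', c', h'⟩ := hg
  refine ⟨A + A', max c c', fun n => ?_⟩
  rw [add_mul]
  exact Nat.add_le_add
    ((h n).trans (Nat.mul_le_mul_left _ (Nat.pow_le_pow_right (by omega) (le_max_left _ _))))
    ((h' n).trans (Nat.mul_le_mul_left _ (Nat.pow_le_pow_right (by omega) (le_max_right _ _))))

theorem mul (hf : PolyBounded f) (hg : PolyBounded g) : PolyBounded fun n => f n * g n := by
  obtain ⟨A, c, h⟩ := hf
  obtain ⟨A', c', h'⟩ := hg
  refine ⟨A * A', c + c', fun n => (Nat.mul_le_mul (h n) (h' n)).trans (le_of_eq ?_)⟩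
  ring

theorem pow (hf : PolyBounded f) (e : ℕ) : PolyBounded fun n => f n ^ e := by
  induction e with
  | zero => simpa using const 1
  | succ e ih => simpa only [pow_succ] using ih.mul hf

end PolyBounded

/-- A bound on the number of steps of `findEdge`. -/
def scanSteps (n : ℕ) : ℕ := findEdge.size * (n + 1) ^ findEdge.depth

/-- A bound on the numbers in the memory when the search begins. -/
def startBound (n : ℕ) : ℕ := n + 1 + scanSteps n + (n + 1) ^ 3

/-- The polynomial factor in the bound on the number of steps of the search. -/
def searchFactor (n : ℕ) : ℕ :=
  2 * (n * n * (n + 1) + 1) * (processNode.size * ((n + 1) ^ 3 + 1) ^ processNode.depth + 1) + 5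

/-- A bound on the bit lengths of the numbers that occur in the search. -/
def searchLength (n : ℕ) : ℕ := startBound n + searchFactor n + n * n * n

/-- The polynomial factor of the running time. -/
def timeFactor (n : ℕ) : ℕ :=
  (100 * scanSteps n * (n + 1 + scanSteps n + 1) + 10) + 90 * (startBound n + 1) +
    100 * searchFactor n * (searchLength n + 1)

theorem polyBounded_timeFactor : PolyBounded timeFactor := by
  have h₀ : PolyBounded fun n => n + 1 := PolyBounded.id.add (.const 1)
  have h₁ : PolyBounded scanSteps := (PolyBounded.const _).mul (h₀.pow _)
  have h₂ : PolyBounded startBound := (h₀.add h₁).add (h₀.pow 3)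
  have h₃ : PolyBounded fun n => n * n := PolyBounded.id.mul .id
  have h₄ : PolyBounded searchFactor :=
    (((PolyBounded.const 2).mul ((h₃.mul h₀).add (.const 1))).mul
      (((PolyBounded.const _).mul (((h₀.pow 3).add (.const 1)).pow _)).add (.const 1))).add (.const 5)
  have h₅ : PolyBounded searchLength := (h₂.add h₄).add (h₃.mul .id)
  exact (((((PolyBounded.const 100).mul h₁).mul ((h₀.add h₁).add (.const 1))).add (.const 10)).add
    ((PolyBounded.const 90).mul (h₂.add (.const 1)))).add
      (((PolyBounded.const 100).mul h₄).mul (h₅.add (.const 1)))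

theorem ceil_mul_add_one_le {x y z : ℝ} (hx : 1 ≤ x) (hz : 1 ≤ z) (hyz : y ≤ z) :
    x * y + 1 ≤ 2 * z * x := by
  nlinarith

theorem add_lt_two_pow_add_mul {a b m e : ℕ} (hm : m ≤ b * 2 ^ e) : a + m < 2 ^ (a + b + e) := by
  have h₁ : 1 ≤ 2 ^ e := Nat.one_le_two_pow
  have h₂ : a + b < 2 ^ (a + b) := Nat.lt_two_pow_self
  rw [pow_add 2 (a + b)]
  nlinarith

theorem nodeBound_steps_le {k' m : ℕ} (hk' : k' ≤ n * n) (hd : d ≤ n)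
    (hm : m ≤ nodeBound n k' d * (processNode.budget ((n + 1) ^ 3) + 1) + 5) :
    (m : ℝ) ≤ searchFactor n * (1.4423 : ℝ) ^ (d * k') ∧ startBound n + m < 2 ^ searchLength n := by
  set b := processNode.size * ((n + 1) ^ 3 + 1) ^ processNode.depth with hb
  have hbud : processNode.budget ((n + 1) ^ 3) ≤ b := Prog.budget_le _ _
  have hx : (1 : ℝ) ≤ (1.4423 : ℝ) ^ (d * k') := one_le_pow₀ (by norm_num)
  have hnode : (nodeBound n k' d : ℝ) ≤
      (2 * (n * n * (n + 1) + 1) : ℕ) * (1.4423 : ℝ) ^ (d * k') := by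
    have h₁ : ((k' * (n + 1) + 1 : ℕ) : ℝ) ≤ (n * n * (n + 1) + 1 : ℕ) := by
      exact_mod_cast Nat.succ_le_succ (Nat.mul_le_mul_right _ hk')
    have h₂ : (1 : ℝ) ≤ (n * n * (n + 1) + 1 : ℕ) := by
      exact_mod_cast Nat.succ_le_succ (Nat.zero_le _)
    have h₃ := Nat.ceil_lt_add_one
      (a := (1.4423 : ℝ) ^ (k' * d) * (k' * (n + 1) + 1 : ℕ)) (by positivity)
    rw [nodeBound]
    refine h₃.le.trans ?_
    rw [mul_comm k' d, Nat.cast_mul 2]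
    exact ceil_mul_add_one_le hx h₂ h₁
  have hreal : (m : ℝ) ≤ searchFactor n * (1.4423 : ℝ) ^ (d * k') := by
    have h₁ : (m : ℝ) ≤ nodeBound n k' d * (b + 1 : ℕ) + 5 := by
      exact_mod_cast hm.trans (Nat.add_le_add_right (Nat.mul_le_mul_left _ (by omega)) 5)
    have h₂ := mul_le_mul_of_nonneg_right hnode (Nat.cast_nonneg (α := ℝ) (b + 1))
    rw [searchFactor, ← hb, Nat.cast_add, Nat.cast_mul, add_mul]
    refine h₁.trans (add_le_add (h₂.trans (le_of_eq (mul_right_comm _ _ _))) ?_)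
    exact le_mul_of_one_le_right (Nat.cast_nonneg 5) hx
  refine ⟨hreal, ?_⟩
  have hpow : (1.4423 : ℝ) ^ (d * k') ≤ ((2 ^ (n * n * n) : ℕ) : ℝ) := by
    push_cast
    calc (1.4423 : ℝ) ^ (d * k') ≤ 2 ^ (d * k') := by gcongr; norm_num
      _ ≤ 2 ^ (n * n * n) := by
        refine pow_le_pow_right₀ (by norm_num) ?_
        rw [mul_comm (n * n) n]
        exact Nat.mul_le_mul hd hk'
  have hm' : m ≤ searchFactor n * 2 ^ (n * n * n) := by
    have := hreal.trans (mul_le_mul_of_nonneg_left hpow (Nat.cast_nonneg _))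
    exact_mod_cast this
  exact add_lt_two_pow_add_mul hm'

theorem run_edgeCliqueCover (n : ℕ) (G : SimpleGraph (Fin n)) (k : ℕ) :
    ∃ s t, Run edgeCliqueCover (input G k) s t ∧ IsCorrectAnswer G k (output n s) ∧
      (t : ℝ) ≤ timeFactor n * (1.4423 : ℝ) ^ (degeneracy G * k) := by
  classical
  set s := input G k with hs
  set a : ℝ := (1.4423 : ℝ) ^ (degeneracy G * k) with ha
  have ha1 : 1 ≤ a := one_le_pow₀ (by norm_num)
  have hn : s.reg rN = n := by simp [hs, input]
  have hk : s.reg rK = k := by simp [hs, input]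
  have hr : ∀ r, r ≠ 0 → r ≠ 1 → s.reg r = 0 := fun r h₀ h₁ => by simp [hs, input, h₀, h₁]
  have hm : ∀ b c, s.mem b c ≤ 1 := fun b c => by
    simp only [hs, input]; split_ifs <;> omega
  have hm0 : ∀ b c, b ≠ 0 → s.mem b c = 0 := fun b c hb => by simp [hs, input, hb]
  -- the search for an edge
  obtain ⟨s₁, m₁, hst₁, hle₁, hfound, hedge⟩ := ensures_findEdge (k := k) (G := G)
  have hm₁ : m₁ ≤ scanSteps n := hle₁.trans (Prog.budget_le _ _)
  have hf₁ := hst₁.frame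
  have hbd : s.BoundedBy (fun i => i ≠ rK) (n + 1) := by
    refine ⟨fun i hi => ?_, fun b c => (hm b c).trans (by omega)⟩
    by_cases h0 : i = 0
    · subst h0; omega
    · rw [hr i h0 (by simpa using hi)]; omega
  obtain ⟨t₁, hrun₁, ht₁, hbd₁⟩ := hst₁.run (Z := fun i => i ≠ rK) (K := 100)
    (L := n + 1 + scanSteps n) (by norm_num) (by decide) hbd (by omega)
    (lt_of_le_of_lt (by omega) Nat.lt_two_pow_self)
  have ht₁' : t₁ ≤ 100 * scanSteps n * (n + 1 + scanSteps n + 1) :=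
    ht₁.trans (Nat.mul_le_mul_right _ (Nat.mul_le_mul_left _ hm₁))
  have hlen1 : ∀ x ≤ 1, len x ≤ 2 := fun x hx => by interval_cases x <;> decide
  have hlenf := hlen1 _ hfound
  by_cases hE : s₁.reg rFound = 0
  · have hno : ∀ u v, ¬ G.Adj u v := fun u v huv =>
      hedge.2 ⟨u, v, (lift_adj u v).2 huv⟩ hE
    refine ⟨_, _, .seq hrun₁ (.cond_false hE (.seq (.assign _ _ _) (.assign _ _ _))), ?_, ?_⟩
    · simp only [output, Expr.eval]
      norm_num
      exact ⟨⟨by simp, fun u v huv => absurd huv (hno u v)⟩, by simp⟩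
    · have h₁ := hlen1 0 (by omega)
      have h₂ := hlen1 1 le_rfl
      simp only [Expr.cost, Expr.eval, hE]
      have h₃ : (t₁ + (len 0 + len 0 + (len 1 + len 1 + (len 0 + len 0)))) ≤ timeFactor n := by
        have h0 : len 0 = 1 := by decide
        rw [timeFactor]; omega
      calc _ ≤ (timeFactor n : ℝ) := by exact_mod_cast h₃
        _ ≤ _ := le_mul_of_one_le_right (Nat.cast_nonneg _) ha1
  -- there is an edge
  obtain ⟨x, y, hxy⟩ := hedge.1 hE
  obtain ⟨u, v, huv, -, -⟩ := exists_of_lift_adj hxy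
  have hd1 : 1 ≤ degeneracy G := one_le_degeneracy huv
  have hn0 : 0 < n := (Nat.zero_le _).trans_lt u.2
  -- reading `k` costs at most about `k`, which is affordable because of `1 ≤ degeneracy G`
  have hka : ((k + 1 : ℕ) : ℝ) ≤ 3 * a := by
    have h₁ := one_add_mul_le_pow (a := (0.4423 : ℝ)) (by norm_num) k
    have h₂ : (1.4423 : ℝ) ^ k ≤ a := pow_le_pow_right₀ (by norm_num) (Nat.le_mul_of_pos_left k hd1)
    have h₃ : (1 : ℝ) + 0.4423 = 1.4423 := by norm_num
    rw [h₃] at h₁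
    have h₄ : (0 : ℝ) ≤ k := Nat.cast_nonneg k
    push_cast
    linarith
  set B := n + 1 + scanSteps n with hB
  have hbd₁' : s₁.BoundedBy (fun i => i ≠ rK) B := hbd₁.mono (by omega)
  have hk₁ : s₁.reg rK = k := (hf₁.reg _ (by decide)).trans hk
  have hn₁ : s₁.reg rN = n := (hf₁.reg _ (by decide)).trans hn
  obtain ⟨s₂, t₂, hrun₂, ht₂, hk₂, hkn₂, hr₂, hmem₂⟩ :=
    run_prepare (B := B) (by omega) hbd₁' hn₁ hk₁
  set k' := min k (n * n) with hk'
  have hk'n : k' ≤ n * n := Nat.min_le_right _ _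
  have hn₂ : s₂.reg rN = n := (hr₂ _ (by decide) (by decide)).trans hn₁
  have hcube : (n + 1) ^ 3 = n * n * n + 3 * (n * n) + 3 * n + 1 := by ring
  have hkn : k' * n ≤ n * n * n := Nat.mul_le_mul_right n hk'n
  have hmem : s₂.mem = s.mem := by
    rw [hmem₂]
    exact funext fun b => hf₁.mem b (by decide +revert)
  have hsetup : Setup (lift G) n k' ((n + 1) ^ 3) s₂ :=
    ⟨hn₂, hk₂, hkn₂, fun v hv x hx => by rw [hmem]; exact input_mem k hv hx, by omega, by omega,
      by omega⟩
  obtain ⟨s₃, m₃, hst₃, hle₃, hout⟩ := steps_search (d := degeneracy G) hsetup hn0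
    (fun x y h => lt_of_lift_adj h) (fun R hR hRn => exists_card_filter_le_degeneracy hR hRn)
    (fun b c hb => by rw [hmem]; exact hm0 b c hb)
    (by rw [hr₂ _ (by decide) (by decide), hf₁.reg _ (by decide)]; exact hr _ (by decide) (by decide))
  obtain ⟨hm₃, hL₃⟩ := nodeBound_steps_le hk'n (degeneracy_le G) hle₃
  have hbd₂ : s₂.BoundedBy (fun _ => true) (startBound n) := by
    refine ⟨fun i _ => ?_, fun b c => ?_⟩
    · rw [startBound]
      by_cases h1 : i = rK
      · subst h1; rw [hk₂]; omega
      by_cases h4 : i = rKN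
      · subst h4; rw [hkn₂]; omega
      rw [hr₂ i h1 h4]
      exact (hbd₁'.1 i (by simpa using h1)).trans (by omega)
    · rw [hmem]
      exact (hm b c).trans (by rw [startBound]; omega)
  obtain ⟨t₃, hrun₃, ht₃, -⟩ := hst₃.run (K := 100) (by norm_num) (by decide) hbd₂
    (by rw [startBound]; omega) hL₃
  refine ⟨s₃, _, .seq hrun₁ (.cond_true hE (.seq hrun₂ hrun₃)), ?_, ?_⟩
  · rcases hout with ⟨h₁, σ, hσ, hj, hrows, hcov⟩ | ⟨h₁, h₂⟩
    · exact isCorrectAnswer_of_covers (Nat.min_le_left _ _) h₁ hσ hj hrows hcov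
    · rw [output, if_pos h₁]
      rintro ⟨𝒞, h𝒞, hcard⟩
      exact h₂ (hasCover_of_isEdgeCliqueCover h𝒞 hcard).min
  · have hpow : (1.4423 : ℝ) ^ (degeneracy G * k') ≤ a :=
      pow_le_pow_right₀ (by norm_num) (Nat.mul_le_mul_left _ (Nat.min_le_left _ _))
    have h₁ : ((Expr.reg rFound).cost s₁ + len ((Expr.reg rFound).eval s₁) + (t₂ + t₃) + t₁ : ℕ) ≤
        (100 * scanSteps n * (n + 1 + scanSteps n + 1) + 10) + 30 * (startBound n + 1) * (k + 1) +
          t₃ := by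
      have h₂ : t₂ ≤ 30 * (startBound n + 1) * (k + 1) := by
        refine ht₂.trans ?_
        have : B ≤ startBound n := by rw [startBound]; omega
        nlinarith
      have h₃ : t₁ ≤ 100 * scanSteps n * (n + 1 + scanSteps n + 1) := ht₁'
      simp only [Expr.cost, Expr.eval]
      omega
    have h₂ : (t₃ : ℝ) ≤ 100 * searchFactor n * (searchLength n + 1) * a := by
      have h₃ : (t₃ : ℝ) ≤ 100 * m₃ * (searchLength n + 1) := by exact_mod_cast ht₃
      have h₄ : (m₃ : ℝ) ≤ searchFactor n * a :=
        hm₃.trans (mul_le_mul_of_nonneg_left hpow (Nat.cast_nonneg _))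
      have h₅ := mul_le_mul_of_nonneg_right h₄ (by positivity : (0 : ℝ) ≤ 100 * (searchLength n + 1))
      linarith
    have h₃ : ((30 * (startBound n + 1) * (k + 1) : ℕ) : ℝ) ≤ 90 * (startBound n + 1) * a := by
      have := mul_le_mul_of_nonneg_left hka
        (by positivity : (0 : ℝ) ≤ 30 * (startBound n + 1))
      push_cast at this ⊢
      linarith
    have h₄ : ((100 * scanSteps n * (n + 1 + scanSteps n + 1) + 10 : ℕ) : ℝ) ≤
        (100 * scanSteps n * (n + 1 + scanSteps n + 1) + 10 : ℕ) * a :=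
      le_mul_of_one_le_right (Nat.cast_nonneg _) ha1
    have h₅ : ((t₁ + ((Expr.reg rFound).cost s₁ + len ((Expr.reg rFound).eval s₁) + (t₂ + t₃)) : ℕ)
        : ℝ) ≤ (100 * scanSteps n * (n + 1 + scanSteps n + 1) + 10 : ℕ) +
          (30 * (startBound n + 1) * (k + 1) : ℕ) + t₃ := by
      rw [add_comm t₁]
      exact_mod_cast h₁
    refine h₅.trans ?_
    rw [timeFactor]
    push_cast at h₃ h₄ ⊢
    linarith

end EdgeCliqueCover

open EdgeCliqueCover in
/-- A single program solves Edge Clique Cover in time `1.4423 ^ (d k) * n ^ O(1)`, where `d` is the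
degeneracy of the input graph and `n` the number of its vertices. -/
theorem theorem1 :
    ∃ (P : Prog) (A c : ℕ), ∀ (n : ℕ) (G : SimpleGraph (Fin n)) (k : ℕ),
      ∃ (s : State) (t : ℕ),
        Run P (input G k) s t ∧
        IsCorrectAnswer G k (output n s) ∧
        (t : ℝ) ≤ (A : ℝ) * (1.4423 : ℝ) ^ (degeneracy G * k) * ((n : ℝ) + 1) ^ c := by
  obtain ⟨A, c, hA⟩ := polyBounded_timeFactor
  refine ⟨edgeCliqueCover, A, c, fun n G k => ?_⟩
  obtain ⟨s, t, hrun, hans, ht⟩ := run_edgeCliqueCover n G k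
  refine ⟨s, t, hrun, hans, ht.trans ?_⟩
  have h : (timeFactor n : ℝ) ≤ A * ((n : ℝ) + 1) ^ c := by exact_mod_cast hA n
  have := mul_le_mul_of_nonneg_right h
    (by positivity : (0 : ℝ) ≤ (1.4423 : ℝ) ^ (degeneracy G * k))
  linarith
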